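/- Let $f:\mathbb R^2\to\mathbb R$, $g:\mathbb R\to\mathbb R$ and $\rho:\mathbb R\to\mathbb R$ be $C^\infty$, let $g$ be periodic with period $T>0$, and let $\rho(0)=0$ and $\rho'(0)=-r$ with $0<r<1$. Fix $c\in\mathbb R$. Let $t\mapsto x(\tau,v;t)$ be the solution, on its maximal interval of existence, of $\ddot x+f(x,\dot x)=g(\tau+t)$ with $x=c$, $\dot x=v$ at $t=0$, and let $a(\tau)=\ddot x(\tau,0;0)=g(\tau)-f(c,0)$. The impact map $G$ is the following partial map of the $(\tau,v)$-plane. Given $(\tau,v)$, let $t_1$ be the first $t>0$ with $x(\tau,v;t)=c$ if $v>0$, or if $v=0$ and $x(\tau,0;t)>c$ for all small $t>0$; let $t_1$ be the first such $t<0$, in the direction of decreasing $t$, if $v<0$; and let $t_1=0$ if $v=0$ and it is not the case that $x(\tau,0;t)>c$ for all small $t>0$. If $t_1$ exists, then $G(\tau,v)=(\tau+t_1,\ \rho(\dot x(\tau,v;t_1)))$; otherwise $G$ is undefined at $(\tau,v)$. Let $J\subset\mathbb R$ be an open interval on which $a$ is negative and bounded away from $0$; identify $J$ with $J\times\{0\}$.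 Then there are an open neighbourhood $U$ of $J$ in the plane and, for each $\tau\in J$, a $C^\infty$ embedded curve $W^s_\tau\subset U$ through $(\tau,0)$, tangent there to the direction $(2,(1-r)a(\tau))$, such that 1. $G$ is defined on $W^s_\tau$ and $G(W^s_\tau)\subset W^s_\tau$; 2. $W^s_\tau=\{u\in U:\ G^n(u)\text{ is defined for all } n\ge 0\text{ and } G^n(u)\to(\tau,0)\text{ as }n\to\infty\}$; 3. the curves form a continuous foliation of $U$: there is a homeomorphism $\Phi:J\times\mathbb R\to U$ with $\Phi(\{\tau\}\times\mathbb R)=W^s_\tau$ for every $\tau\in J$. -/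

import Mathlib

open Set Filter Topology
open scoped ContDiff

namespace ImpactOscillator

/-- The pair `(x, y)` solves `x' = y`, `y' + f (x, y) = g t` on the open interval `I`;
that is, `x` solves `x'' + f (x, x') = g t` on `I` and `y` is its velocity `x'`. -/
structure IsSolutionOn (f : ℝ → ℝ → ℝ) (g : ℝ → ℝ) (I : Set ℝ) (x y : ℝ → ℝ) : Prop where
  isOpen : IsOpen I
  ordConnected : I.OrdConnected
  hasDerivAt_position : ∀ t ∈ I, HasDerivAt x (y t) t
  hasDerivAt_velocity : ∀ t ∈ I, HasDerivAt y (g t - f (x t) (y t)) t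

/-- The solution with position `c` and velocity `v` at time `τ` is defined up to time `τ + t`
(`t` of either sign), and its position and velocity at time `τ + t` are `b` and `u`.
In other words `x_c(τ, v; t) = b` and `ẋ_c(τ, v; t) = u`. -/
def StateAt (f : ℝ → ℝ → ℝ) (g : ℝ → ℝ) (c τ v t b u : ℝ) : Prop :=
  ∃ (I : Set ℝ) (x y : ℝ → ℝ), IsSolutionOn f g I x y ∧ τ ∈ I ∧ τ + t ∈ I ∧
    x τ = c ∧ y τ = v ∧ x (τ + t) = b ∧ y (τ + t) = u

/-- The impact surface `V_c`: the triples `(τ, v, t)` with `x_c(τ, v; t) = c`. -/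
def impactSurface (f : ℝ → ℝ → ℝ) (g : ℝ → ℝ) (c : ℝ) : Set (ℝ × ℝ × ℝ) :=
  {z | ∃ u, StateAt f g c z.1 z.2.1 z.2.2 c u}

/-- The initial acceleration `a_c(τ) = ẍ_c(τ, 0; 0)` of the solution that starts at time `τ`
at `x = c` with velocity zero, as given by the differential equation. -/
def initialAcceleration (f : ℝ → ℝ → ℝ) (g : ℝ → ℝ) (c τ : ℝ) : ℝ :=
  g τ - f c 0

/-- The solution starting at time `τ` at `x = c` with zero velocity satisfies `x > c` for all
sufficiently small positive times. -/
def LiftsOff (f : ℝ → ℝ → ℝ) (g : ℝ → ℝ) (c τ : ℝ) : Prop :=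
  ∀ᶠ t in 𝓝[>] (0 : ℝ), ∃ b u, StateAt f g c τ 0 t b u ∧ c < b

/-- `(τ, v, t)` is the first hit `F_c(τ, v)`.
For `v > 0`, and for `v = 0` when the solution lifts off, it is the first point of the impact
surface met from `(τ, v, 0)` in the direction of increasing `t`;
for `v < 0` it is the first one met in the direction of decreasing `t`;
for `v = 0` without lift-off the orbit rests at the obstacle and `t = 0`.
No such `t` exists where `F_c` is not defined. -/
def IsFirstHit (f : ℝ → ℝ → ℝ) (g : ℝ → ℝ) (c τ v t : ℝ) : Prop :=
  (τ, v, t) ∈ impactSurface f g c ∧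
    (((0 < v ∨ (v = 0 ∧ LiftsOff f g c τ)) ∧ 0 < t ∧
        ∀ s ∈ Ioo 0 t, (τ, v, s) ∉ impactSurface f g c) ∨
      (v < 0 ∧ t < 0 ∧ ∀ s ∈ Ioo t 0, (τ, v, s) ∉ impactSurface f g c) ∨
      (v = 0 ∧ ¬ LiftsOff f g c τ ∧ t = 0))

/-- The re-set map `φ_c`, as a relation: it sends a point `(τ, v, t)` of the impact surface
to `(τ + t, ẋ_c(τ, v; t))`. -/
def IsReset (f : ℝ → ℝ → ℝ) (g : ℝ → ℝ) (c τ v t : ℝ) (w : ℝ × ℝ) : Prop :=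
  ∃ u, StateAt f g c τ v t c u ∧ w = (τ + t, u)

/-- The restitution map `R`. -/
def restitution (ρ : ℝ → ℝ) (w : ℝ × ℝ) : ℝ × ℝ :=
  (w.1, ρ w.2)

/-- The graph of the impact map `G = R ∘ φ_c ∘ F_c`, a partial map of the `(τ, v)`-plane:
`G` is defined at `w` and `G w = w'`. -/
def ImpactStep (f : ℝ → ℝ → ℝ) (g : ℝ → ℝ) (c : ℝ) (ρ : ℝ → ℝ) (w w' : ℝ × ℝ) : Prop :=
  ∃ t w₁, IsFirstHit f g c w.1 w.2 t ∧ IsReset f g c w.1 w.2 t w₁ ∧ w' = restitution ρ w₁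

/-- The set of all `u ∈ U` such that all the iterates `G^n u` are defined and
`G^n u → w` as `n → ∞`. -/
def localStableSet (f : ℝ → ℝ → ℝ) (g : ℝ → ℝ) (c : ℝ) (ρ : ℝ → ℝ)
    (U : Set (ℝ × ℝ)) (w : ℝ × ℝ) : Set (ℝ × ℝ) :=
  {u ∈ U | ∃ orbit : ℕ → ℝ × ℝ, orbit 0 = u ∧
    (∀ n, ImpactStep f g c ρ (orbit n) (orbit (n + 1))) ∧ Tendsto orbit atTop (𝓝 w)}

/-- `W` is a smooth (`C^∞`) embedded curve in the plane, the image of an open interval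
(which may be taken to be `ℝ`), passing through `w` with tangent vector `d` there. -/
def IsSmoothCurveThrough (W : Set (ℝ × ℝ)) (w d : ℝ × ℝ) : Prop :=
  ∃ γ : ℝ → ℝ × ℝ, ContDiff ℝ ∞ γ ∧ IsEmbedding γ ∧ (∀ s, deriv γ s ≠ 0) ∧
    range γ = W ∧ γ 0 = w ∧ deriv γ 0 = d



/-- `initialAcceleration` is the second derivative of the solution at its initial time. -/
theorem IsSolutionOn.initialAcceleration_eq {f : ℝ → ℝ → ℝ} {g : ℝ → ℝ} {I : Set ℝ} {x y : ℝ → ℝ}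
    {c τ : ℝ} (h : IsSolutionOn f g I x y) (hτ : τ ∈ I) (hx : x τ = c) (hy : y τ = 0) :
    HasDerivAt y (initialAcceleration f g c τ) τ := by
  have := h.hasDerivAt_velocity τ hτ
  rwa [hx, hy] at this

open scoped Manifold in
/-- Uniqueness of integral curves of a `C^1` vector field on a normed space. -/
theorem eqOn_of_hasDerivAt {E : Type*} [NormedAddCommGroup E] [NormedSpace ℝ E] [CompleteSpace E]
    {V : E → E} (hV : ContDiff ℝ 1 V) {a d t₀ : ℝ} (h₀ : t₀ ∈ Ioo a d) {γ γ' : ℝ → E}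
    (h : ∀ s ∈ Ioo a d, HasDerivAt γ (V (γ s)) s) (h' : ∀ s ∈ Ioo a d, HasDerivAt γ' (V (γ' s)) s)
    (he : γ t₀ = γ' t₀) : EqOn γ γ' (Ioo a d) := by
  let W : (x : E) → TangentSpace 𝓘(ℝ, E) x := V
  refine isMIntegralCurveOn_Ioo_eqOn_of_contMDiff_boundaryless (I := 𝓘(ℝ, E)) (v := W) h₀
    (contMDiff_vectorSpace_iff_contDiff.2 hV) (fun s hs => ?_) (fun s hs => ?_) he
  · exact (h s hs).hasFDerivAt.hasFDerivWithinAt.hasMFDerivWithinAt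
  · exact (h' s hs).hasFDerivAt.hasFDerivWithinAt.hasMFDerivWithinAt

/-- The state at a given time is determined by the initial data. -/
theorem StateAt.unique {f : ℝ → ℝ → ℝ} {g : ℝ → ℝ} (hf : ContDiff ℝ ∞ (Function.uncurry f))
    (hg : ContDiff ℝ ∞ g) {c τ v t b u b' u' : ℝ}
    (h : StateAt f g c τ v t b u) (h' : StateAt f g c τ v t b' u') : b = b' ∧ u = u' := by
  obtain ⟨I, x, y, hs, h0, h1, rfl, rfl, rfl, rfl⟩ := h
  obtain ⟨I', x', y', hs', h0', h1', e1, e2, rfl, rfl⟩ := h'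
  set K := I ∩ I' with hK
  have hKo : IsOpen K := hs.isOpen.inter hs'.isOpen
  have hKc : K.OrdConnected := hs.ordConnected.inter hs'.ordConnected
  have m0 : τ ∈ K := ⟨h0, h0'⟩
  have m1 : τ + t ∈ K := ⟨h1, h1'⟩
  obtain ⟨a, d, hm0, hm1, hsub⟩ : ∃ a d, τ ∈ Ioo a d ∧ τ + t ∈ Ioo a d ∧ Ioo a d ⊆ K := by
    obtain ⟨ε, hε, H0⟩ := Metric.isOpen_iff.1 hKo _ m0
    obtain ⟨η, hη, H1⟩ := Metric.isOpen_iff.1 hKo _ m1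
    rw [Real.ball_eq_Ioo] at H0 H1
    rcases le_total 0 t with ht | ht
    · refine ⟨τ - ε, τ + t + η, ⟨by linarith, by linarith⟩, ⟨by linarith, by linarith⟩, ?_⟩
      intro s hs
      rcases lt_or_ge s τ with h | h
      · exact H0 ⟨hs.1, by linarith⟩
      rcases lt_or_ge (τ + t) s with h2 | h2
      · exact H1 ⟨by linarith, hs.2⟩
      exact hKc.out m0 m1 ⟨h, h2⟩
    · refine ⟨τ + t - η, τ + ε, ⟨by linarith, by linarith⟩, ⟨by linarith, by linarith⟩, ?_⟩
      intro s hs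
      rcases lt_or_ge s (τ + t) with h | h
      · exact H1 ⟨hs.1, by linarith⟩
      rcases lt_or_ge τ s with h2 | h2
      · exact H0 ⟨by linarith, hs.2⟩
      exact hKc.out m1 m0 ⟨h, h2⟩
  let V : ℝ × ℝ × ℝ → ℝ × ℝ × ℝ := fun p => (1, p.2.2, g p.1 - f p.2.1 p.2.2)
  have hV : ContDiff ℝ 1 V := by
    have hg1 : ContDiff ℝ 1 g := hg.of_le (by exact_mod_cast le_top)
    have hf1 : ContDiff ℝ 1 (Function.uncurry f) := hf.of_le (by exact_mod_cast le_top)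
    refine contDiff_const.prodMk (contDiff_snd.snd.prodMk ?_)
    refine (hg1.comp contDiff_fst).sub ?_
    exact hf1.comp (contDiff_snd.fst.prodMk contDiff_snd.snd)
  have key : ∀ x y : ℝ → ℝ, (∀ s ∈ Ioo a d,
      HasDerivAt x (y s) s ∧ HasDerivAt y (g s - f (x s) (y s)) s) →
      ∀ s ∈ Ioo a d, HasDerivAt (fun s => (s, x s, y s)) (V (s, x s, y s)) s := fun x y H s hs =>
    (hasDerivAt_id s).prodMk ((H s hs).1.prodMk (H s hs).2)
  have h2 := eqOn_of_hasDerivAt hV hm0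
    (key x y fun s hs1 =>
      ⟨hs.hasDerivAt_position s (hsub hs1).1, hs.hasDerivAt_velocity s (hsub hs1).1⟩)
    (key x' y' fun s hs1 =>
      ⟨hs'.hasDerivAt_position s (hsub hs1).2, hs'.hasDerivAt_velocity s (hsub hs1).2⟩)
    (by simp [e1, e2]) hm1
  simp only [Prod.mk.injEq, true_and] at h2
  exact h2

/-- The first hit is unique where it exists. -/
theorem IsFirstHit.unique {f : ℝ → ℝ → ℝ} {g : ℝ → ℝ} {c τ v t t' : ℝ}
    (h : IsFirstHit f g c τ v t) (h' : IsFirstHit f g c τ v t') : t = t' := by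
  obtain ⟨hm, h⟩ := h
  obtain ⟨hm', h'⟩ := h'
  rcases h with ⟨hv, ht, h⟩ | ⟨hv, ht, h⟩ | ⟨hv, hl, ht⟩ <;>
  rcases h' with ⟨hv', ht', h'⟩ | ⟨hv', ht', h'⟩ | ⟨hv', hl', ht'⟩
  · by_contra hne
    rcases lt_or_gt_of_ne hne with hlt | hlt
    · exact h' _ ⟨ht, hlt⟩ hm
    · exact h _ ⟨ht', hlt⟩ hm'
  · rcases hv with hv | hv <;> [linarith; linarith [hv.1]]
  · rcases hv with hv | hv <;> [linarith; exact absurd hv.2 hl']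
  · rcases hv' with hv' | hv' <;> [linarith; linarith [hv'.1]]
  · by_contra hne
    rcases lt_or_gt_of_ne hne with hlt | hlt
    · exact h _ ⟨hlt, ht'⟩ hm'
    · exact h' _ ⟨hlt, ht⟩ hm
  · linarith
  · rcases hv' with hv' | hv' <;> [linarith; exact absurd hv'.2 hl]
  · linarith
  · rw [ht, ht']

/-- `G` is a partial map: by uniqueness of solutions, its value is unique where it is defined. -/
theorem ImpactStep.unique {f : ℝ → ℝ → ℝ} {g : ℝ → ℝ} (hf : ContDiff ℝ ∞ (Function.uncurry f))
    (hg : ContDiff ℝ ∞ g) {c : ℝ} {ρ : ℝ → ℝ} {w w' w'' : ℝ × ℝ}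
    (h : ImpactStep f g c ρ w w') (h' : ImpactStep f g c ρ w w'') : w' = w'' := by
  obtain ⟨t, _, ht, ⟨u, hu, rfl⟩, rfl⟩ := h
  obtain ⟨t', _, ht', ⟨u', hu', rfl⟩, rfl⟩ := h'
  obtain rfl := ht.unique ht'
  rw [(hu.unique hf hg hu').2]

end ImpactOscillator

/-!
On `J` the initial acceleration `a` is negative, so that a solution started at `x = c` with a small
velocity `v` returns to `c` after a time close to `-2 v / a`, with velocity close to `-v`. Hence the
impact map `G` is smooth near `J × {0}`, all points of `J × {0}` are fixed by it, and its derivative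
at `(τ, 0)` has the eigenvalues `1`, along `J`, and `r`, in the direction `(2, (1 - r) a)`. The line
of fixed points is normally attracting, and the curves `W τ` are the leaves of its stable foliation.

Three applications of the implicit function theorem carry the proof. The unknown is a function in
the first, a number in the second and a sequence in the third. The equations in function and
sequence spaces are smooth because the superposition operators `u ↦ V ∘ u` on `C(K, E)`, for compact
`K`, are smooth (`contDiff_superposition`).

* The unknown of the first is the solution of the differential equation in a time rescaled so that
  the time of flight `t` becomes a parameter (`exists_flow_expansion`). It exhibits the position as
  `c + t (v + t M)` and the velocity as `v + t N`.
* The second solves `v + t M = 0` for `t`. It gives `G` the form `(τ + v α, v β)` with smooth `α`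
  and `β`, where `α = -2 / a` and `β = r` at `v = 0` (`exists_impactStep_normalForm`).
* The unknown of the third is a whole orbit of `G` with limit `(σ, 0)`, written as
  `(σ + qⁿ eₙ, qⁿ wₙ)` with `r < q < 1` and started at height `v` (`exists_stable_orbit_family`).
  The first coordinate `h (σ, v)` of its starting point is a smooth function, and the leaf of `σ` is
  the graph `{(h (σ, v), v)}`.

As `∂h/∂σ = 1` at `v = 0`, the graphs fill a neighbourhood, and every attracted point near `J × {0}`
lies on the graph that belongs to its limit (`exists_local_stable_foliation`). The local graphs are
glued to leaves of the form `{(H (τ, v), v) : |v| < η τ}` with a continuous radius `η` on `J`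
(`exists_global_foliation`), and `U` is the union of these leaves. A leaf is then exactly the set of
the points of `U` that are attracted to `(τ, 0)`, because an orbit has only one limit.
-/

namespace ImpactOscillator

/-! ### Superposition operators -/

section Superposition

/-- The superposition (Nemytskii) operator `u ↦ V ∘ u` between spaces of continuous maps. -/
def superposition {K E F : Type} [TopologicalSpace K] [TopologicalSpace E] [TopologicalSpace F]
    (V : E → F) (hV : Continuous V) (u : C(K, E)) : C(K, F) :=
  (⟨V, hV⟩ : C(E, F)).comp u

@[simp] lemma superposition_apply {K E F : Type} [TopologicalSpace K] [TopologicalSpace E]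
    [TopologicalSpace F] (V : E → F) (hV : Continuous V) (u : C(K, E)) (k : K) :
    superposition V hV u k = V (u k) := rfl

lemma continuous_superposition {K E F : Type} [TopologicalSpace K] [TopologicalSpace E]
    [TopologicalSpace F] (V : E → F) (hV : Continuous V) :
    Continuous (superposition V hV : C(K, E) → C(K, F)) :=
  ContinuousMap.continuous_postcomp _

lemma exists_forall_dist_superposition_lt {K E F : Type} [TopologicalSpace K] [CompactSpace K]
    [PseudoMetricSpace E] [PseudoMetricSpace F]
    {V : E → F} (hV : Continuous V) (u : C(K, E)) {ε : ℝ} (hε : 0 < ε) :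
    ∃ δ > 0, ∀ v : C(K, E), dist v u < δ →
      ∀ k, dist (V (v k)) (V (u k)) < ε := by
  have hc : ContinuousAt (superposition V hV : C(K, E) → C(K, F)) u :=
    (continuous_superposition V hV).continuousAt
  obtain ⟨δ, hδ, H⟩ := (Metric.continuousAt_iff (α := C(K, E)) (β := C(K, F))).1 hc ε hε
  exact ⟨δ, hδ, fun v hv k => (ContinuousMap.dist_apply_le_dist k).trans_lt (H hv)⟩

variable {K E F : Type} [TopologicalSpace K] [CompactSpace K]
  [NormedAddCommGroup E] [NormedSpace ℝ E] [NormedAddCommGroup F] [NormedSpace ℝ F]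

/-- The pointwise application of a continuous family of operators to a continuous family of
vectors, as a continuous bilinear map. -/
noncomputable def pointwiseApply : C(K, E →L[ℝ] F) →L[ℝ] C(K, E) →L[ℝ] C(K, F) :=
  LinearMap.mkContinuous₂
    (LinearMap.mk₂ ℝ (fun (A : C(K, E →L[ℝ] F)) (h : C(K, E)) =>
        (⟨fun k => A k (h k), by fun_prop⟩ : C(K, F)))
      (fun _ _ _ => by ext; simp) (fun _ _ _ => by ext; simp)
      (fun _ _ _ => by ext; simp) (fun _ _ _ => by ext; simp)) 1 fun A h => by
    rw [ContinuousMap.norm_le _ (by positivity)]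
    intro k
    rw [one_mul]
    exact ((A k).le_opNorm (h k)).trans
      (mul_le_mul (A.norm_coe_le_norm k) (h.norm_coe_le_norm k) (norm_nonneg _) (by positivity))

/-- The derivative of the superposition operator at `u` is pointwise application of `V' ∘ u`. -/
lemma hasFDerivAt_superposition {V : E → F} (hV : ContDiff ℝ 1 V) (u : C(K, E)) :
    HasFDerivAt (superposition V hV.continuous)
      (pointwiseApply (superposition (fderiv ℝ V) (hV.continuous_fderiv one_ne_zero) u)) u := by
  rw [hasFDerivAt_iff_isLittleO_nhds_zero, Asymptotics.isLittleO_iff]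
  intro ε hε
  obtain ⟨δ, hδ, H⟩ := exists_forall_dist_superposition_lt
    (hV.continuous_fderiv one_ne_zero) u hε
  filter_upwards [Metric.ball_mem_nhds 0 hδ] with h hh
  rw [ContinuousMap.norm_le _ (by positivity)]
  intro k
  have hk : ‖h k‖ < δ := (h.norm_coe_le_norm k).trans_lt (by simpa using hh)
  have key := (convex_ball (u k) δ).norm_image_sub_le_of_norm_hasFDerivWithin_le'
    (f := V) (f' := fderiv ℝ V) (φ := fderiv ℝ V (u k)) (C := ε) (x := u k) (y := u k + h k)
    (fun x _ => (hV.differentiable one_ne_zero x).hasFDerivAt.hasFDerivWithinAt)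
    (fun x hx => by
      have h1 : dist (u + ContinuousMap.const K (x - u k)) u < δ := by
        rw [dist_eq_norm, add_sub_cancel_left, ContinuousMap.norm_lt_iff _ hδ]
        intro _
        simpa [dist_eq_norm] using hx
      have h2 := H _ h1 k
      rw [dist_eq_norm] at h2
      simpa using h2.le)
    (Metric.mem_ball_self hδ) (by simpa [dist_eq_norm] using hk)
  rw [add_sub_cancel_left] at key
  exact key.trans (mul_le_mul_of_nonneg_left (h.norm_coe_le_norm k) hε.le)

/-- The version of `contDiff_superposition` of finite order. The target space varies in the
induction, because the derivative of `V` takes values in `E →L[ℝ] F`. -/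
lemma contDiff_superposition_nat (n : ℕ) : ∀ {F : Type} [NormedAddCommGroup F] [NormedSpace ℝ F]
    {V : E → F} (hV : ContDiff ℝ n V),
    ContDiff ℝ n (superposition V hV.continuous : C(K, E) → C(K, F)) := by
  induction n with
  | zero =>
    intro F _ _ V hV
    exact contDiff_zero.2 (continuous_superposition V hV.continuous)
  | succ n ih =>
    intro F _ _ V hV
    have h1 : ContDiff ℝ 1 V := hV.of_le (by exact_mod_cast Nat.le_add_left 1 n)
    have h2 : ContDiff ℝ n (fderiv ℝ V) := hV.fderiv_right (by norm_cast)
    have hd := fun u : C(K, E) => hasFDerivAt_superposition h1 u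
    have he : fderiv ℝ (superposition V hV.continuous : C(K, E) → C(K, F)) =
        fun u => pointwiseApply (superposition (fderiv ℝ V) h2.continuous u) :=
      funext fun u => (hd u).fderiv
    push_cast
    rw [contDiff_succ_iff_fderiv]
    refine ⟨fun u => (hd u).differentiableAt, by simp, ?_⟩
    rw [he]
    exact pointwiseApply.contDiff.comp (ih h2)

/-- Superposition with a smooth map is smooth: its derivative is again built from a superposition
operator, that of `fderiv ℝ V`. -/
theorem contDiff_superposition {V : E → F} (hV : ContDiff ℝ ∞ V) :
    ContDiff ℝ ∞ (superposition V hV.continuous : C(K, E) → C(K, F)) :=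
  contDiff_infty.2 fun n => contDiff_superposition_nat n (hV.of_le (by exact_mod_cast le_top))

end Superposition

/-! ### Calculus: implicit functions, cutoffs and Hadamard's lemma -/

section Calculus

/-- The implicit function theorem with an implicit function that is `C^∞` on a neighbourhood of the
base point. Smoothness at the base point alone would be weaker: there the neighbourhood on which
the function is `C^n` may shrink as `n` grows. -/
theorem exists_contDiffAt_implicit {P X Y : Type*} [NormedAddCommGroup P] [NormedSpace ℝ P]
    [CompleteSpace P] [NormedAddCommGroup X] [NormedSpace ℝ X] [CompleteSpace X]
    [NormedAddCommGroup Y] [NormedSpace ℝ Y] [CompleteSpace Y] {F : P × X → Y} {p₀ : P} {x₀ : X}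
    (hF : ∀ᶠ z in 𝓝 (p₀, x₀), ContDiffAt ℝ ∞ F z) (h₀ : F (p₀, x₀) = 0) (L : X ≃L[ℝ] Y)
    (hL : HasFDerivAt (fun x => F (p₀, x)) (L : X →L[ℝ] Y) x₀) :
    ∃ φ : P → X, φ p₀ = x₀ ∧ ∀ᶠ p in 𝓝 p₀, ContDiffAt ℝ ∞ φ p ∧ F (p, φ p) = 0 := by
  have h1 : (∞ : WithTop ℕ∞) ≠ 0 := by simp
  have hc := hF.self_of_nhds
  have hinv : (fderiv ℝ F (p₀, x₀) ∘L .inr ℝ P X).IsInvertible := by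
    have h := (hc.differentiableAt h1).hasFDerivAt.comp x₀ (hasFDerivAt_prodMk_right p₀ x₀)
    rw [h.unique hL]
    exact ContinuousLinearMap.isInvertible_equiv
  -- invertibility of the partial derivative is an open condition
  have hopen : ∀ᶠ z in 𝓝 (p₀, x₀), (fderiv ℝ F z ∘L .inr ℝ P X).IsInvertible := by
    obtain ⟨e, he⟩ := hinv
    have hcont : ContinuousAt (fun z => fderiv ℝ F z ∘L .inr ℝ P X) (p₀, x₀) :=
      (hc.continuousAt_fderiv h1).clm_comp continuousAt_const
    have := hcont.preimage_mem_nhds (by rw [← he]; exact e.nhds)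
    filter_upwards [this] with z hz
    obtain ⟨e', he'⟩ := hz
    exact ⟨e', he'⟩
  set φ := hc.implicitFunction h1 hinv with hφ
  have hφ0 : φ p₀ = x₀ := hc.implicitFunction_apply_self h1 hinv
  have hφc : ∀ᶠ p in 𝓝 p₀, ContDiffAt ℝ 1 φ p :=
    ((hc.contDiffAt_implicitFunction h1 hinv).of_le (by exact_mod_cast le_top)).eventually (by simp)
  have hz : ∀ᶠ p in 𝓝 p₀, F (p, φ p) = 0 := by
    have := hc.eventually_apply_implicitFunction h1 hinv
    rwa [h₀] at this
  have ht : Tendsto (fun p => (p, φ p)) (𝓝 p₀) (𝓝 (p₀, x₀)) := by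
    have h := hφc.self_of_nhds.continuousAt
    rw [ContinuousAt, hφ0] at h
    exact tendsto_id.prodMk_nhds h
  refine ⟨φ, hφ0, ?_⟩
  filter_upwards [hφc, hz, hz.eventually_nhds, ht.eventually hF, ht.eventually hopen]
    with p hp1 hp2 hp3 hp4 hp5
  refine ⟨?_, hp2⟩
  -- near `p` the function agrees with the one obtained from the base point `(p, φ p)`
  refine (hp4.contDiffAt_implicitFunction h1 hp5).congr_of_eventuallyEq ?_
  have ht' : Tendsto (fun p => (p, φ p)) (𝓝 p) (𝓝 (p, φ p)) :=
    tendsto_id.prodMk_nhds hp1.continuousAt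
  filter_upwards [ht'.eventually (hp4.eventually_apply_eq_iff_implicitFunction h1 hp5), hp3]
    with q hq hq3
  exact (hq.1 (by rw [hq3, hp2])).symm

/-- A function that is smooth near a point coincides near that point with a globally smooth one. -/
theorem exists_contDiff_eventuallyEq {E F : Type*} [NormedAddCommGroup E] [NormedSpace ℝ E]
    [FiniteDimensional ℝ E] [NormedAddCommGroup F] [NormedSpace ℝ F] {f : E → F} {x₀ : E}
    (hf : ∀ᶠ x in 𝓝 x₀, ContDiffAt ℝ ∞ f x) :
    ∃ F₀ : E → F, ContDiff ℝ ∞ F₀ ∧ F₀ =ᶠ[𝓝 x₀] f := by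
  obtain ⟨ε, hε, H⟩ := Metric.eventually_nhds_iff_ball.1 hf
  let b : ContDiffBump x₀ := ⟨ε / 4, ε / 2, by positivity, by linarith⟩
  refine ⟨fun x => b x • f x, contDiff_iff_contDiffAt.2 fun x => ?_, ?_⟩
  · by_cases hx : x ∈ Metric.ball x₀ ε
    · exact b.contDiffAt.smul (H x hx)
    · have hx' : x ∉ tsupport b := by
        rw [b.tsupport_eq]
        intro h
        exact hx (Metric.closedBall_subset_ball (by simp only [b]; linarith) h)
      have : (fun x => b x • f x) =ᶠ[𝓝 x] fun _ => 0 := by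
        filter_upwards [notMem_tsupport_iff_eventuallyEq.1 hx'] with y hy
        simp [hy]
      exact contDiffAt_const.congr_of_eventuallyEq this
  · filter_upwards [b.eventuallyEq_one] with x hx
    simp [hx]

lemma continuous_IccExtend {E : Type} [TopologicalSpace E] (u : C(Icc (-2 : ℝ) 2, E)) :
    Continuous (IccExtend (by norm_num : (-2 : ℝ) ≤ 2) u) := u.continuous.Icc_extend'

variable {E : Type} [NormedAddCommGroup E] [NormedSpace ℝ E]

/-- The operator `u ↦ ∫₀ˢ u` on continuous functions of `s ∈ [-2, 2]`. Solutions are needed for `s`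
in `[0, 1]` only; the larger interval makes these times interior points. -/
noncomputable def primitive : C(Icc (-2 : ℝ) 2, E) →L[ℝ] C(Icc (-2 : ℝ) 2, E) :=
  LinearMap.mkContinuous
    { toFun := fun u => ⟨fun s => ∫ x in (0 : ℝ)..s, IccExtend (by norm_num : (-2 : ℝ) ≤ 2) u x,
        (intervalIntegral.continuous_primitive
          (fun a b => (continuous_IccExtend u).intervalIntegrable a b) 0).comp
          continuous_subtype_val⟩
      map_add' := fun u v => by
        ext s
        exact intervalIntegral.integral_add ((continuous_IccExtend u).intervalIntegrable _ _)
          ((continuous_IccExtend v).intervalIntegrable _ _)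
      map_smul' := fun a u => by
        ext s
        exact intervalIntegral.integral_smul a _ } 2 fun u => by
    rw [ContinuousMap.norm_le _ (by positivity)]
    intro s
    refine (intervalIntegral.norm_integral_le_of_norm_le_const (C := ‖u‖) fun x _ =>
      u.norm_coe_le_norm _).trans ?_
    rw [sub_zero, mul_comm]
    gcongr
    exact abs_le.2 s.2

lemma primitive_apply (u : C(Icc (-2 : ℝ) 2, E)) (s : Icc (-2 : ℝ) 2) :
    primitive u s = ∫ x in (0 : ℝ)..s, IccExtend (by norm_num : (-2 : ℝ) ≤ 2) u x := rfl

lemma hasDerivAt_primitive [CompleteSpace E] (u : C(Icc (-2 : ℝ) 2, E)) (s : ℝ)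
    (hs : s ∈ Ioo (-2 : ℝ) 2) :
    HasDerivAt (IccExtend (by norm_num : (-2 : ℝ) ≤ 2) (primitive u))
      (IccExtend (by norm_num : (-2 : ℝ) ≤ 2) u s) s := by
  have h := (continuous_IccExtend u).integral_hasStrictDerivAt 0 s
  refine h.hasDerivAt.congr_of_eventuallyEq ?_
  filter_upwards [Ioo_mem_nhds hs.1 hs.2] with t ht
  rw [IccExtend_of_mem _ _ ⟨ht.1.le, ht.2.le⟩, primitive_apply]

lemma primitive_const [CompleteSpace E] (a : E) (s : Icc (-2 : ℝ) 2) :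
    primitive (ContinuousMap.const _ a) s = (s : ℝ) • a := by
  have : IccExtend (by norm_num : (-2 : ℝ) ≤ 2) (ContinuousMap.const (Icc (-2 : ℝ) 2) a) =
      fun _ => a := rfl
  rw [primitive_apply, this]
  simp

lemma clm_primitive [CompleteSpace E] {F : Type} [NormedAddCommGroup F] [NormedSpace ℝ F]
    [CompleteSpace F] (L : E →L[ℝ] F) (u : C(Icc (-2 : ℝ) 2, E)) (s : Icc (-2 : ℝ) 2) :
    L (primitive u s) = primitive (L.compLeftContinuous ℝ _ u) s :=
  (L.intervalIntegral_comp_comm ((continuous_IccExtend u).intervalIntegrable _ _)).symm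

lemma primitive_eq_of_hasDerivAt [CompleteSpace E] {f : ℝ → E} (u : C(Icc (-2 : ℝ) 2, E))
    (hf : ∀ s : Icc (-2 : ℝ) 2, HasDerivAt f (u s) s) (s : Icc (-2 : ℝ) 2) :
    primitive u s = f s - f 0 := by
  rw [primitive_apply]
  refine intervalIntegral.integral_eq_sub_of_hasDerivAt (fun x hx => ?_)
    ((continuous_IccExtend u).intervalIntegrable _ _)
  have hx : x ∈ Icc (-2 : ℝ) 2 :=
    (uIcc_subset_Icc (by norm_num : (0 : ℝ) ∈ Icc (-2 : ℝ) 2) s.2) hx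
  rw [IccExtend_of_mem _ _ hx]
  exact hf ⟨x, hx⟩

/-- The constant maps, as a continuous linear map. -/
noncomputable def constCLM (K E : Type) [NormedAddCommGroup E] [NormedSpace ℝ E]
    [TopologicalSpace K] [CompactSpace K] : E →L[ℝ] C(K, E) :=
  LinearMap.mkContinuous
    { toFun := ContinuousMap.const K
      map_add' := fun _ _ => rfl
      map_smul' := fun _ _ => rfl } 1 fun a => by
    rw [ContinuousMap.norm_le _ (by positivity)]
    exact fun _ => (one_mul _).ge

@[simp] lemma constCLM_apply {K : Type} [TopologicalSpace K] [CompactSpace K] (a : E) (k : K) :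
    constCLM K E a k = a := rfl

lemma contDiff_constCLM {K : Type} [TopologicalSpace K] [CompactSpace K] :
    ContDiff ℝ ∞ (fun a : E => constCLM K E a) :=
  (constCLM K E).contDiff

lemma contDiff_eval {K : Type} [TopologicalSpace K] [CompactSpace K] (k : K) :
    ContDiff ℝ ∞ (fun u : C(K, E) => u k) :=
  (ContinuousMap.evalCLM ℝ k : C(K, E) →L[ℝ] E).contDiff

lemma contDiff_primitive : ContDiff ℝ ∞ (fun u : C(Icc (-2 : ℝ) 2, E) => primitive u) :=
  (primitive : C(Icc (-2 : ℝ) 2, E) →L[ℝ] C(Icc (-2 : ℝ) 2, E)).contDiff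

/-- Hadamard's lemma on the line: a smooth function that vanishes at `0` is `y` times the smooth
function `y ↦ ∫₀¹ ρ' (s y) ds`. -/
theorem exists_contDiff_eq_mul {ρ : ℝ → ℝ} (hρ : ContDiff ℝ ∞ ρ) (h0 : ρ 0 = 0) :
    ∃ κ : ℝ → ℝ, ContDiff ℝ ∞ κ ∧ (∀ y, ρ y = y * κ y) ∧ κ 0 = deriv ρ 0 := by
  have hρ' : ContDiff ℝ ∞ (deriv ρ) := ((contDiff_infty_iff_deriv).1 hρ).2
  let idK : C(Icc (-2 : ℝ) 2, ℝ) := ⟨Subtype.val, continuous_subtype_val⟩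
  let one : Icc (-2 : ℝ) 2 := ⟨1, by norm_num⟩
  let D : ℝ → C(Icc (-2 : ℝ) 2, ℝ) := fun y => superposition (deriv ρ) hρ'.continuous (y • idK)
  have hD : ContDiff ℝ ∞ D :=
    (contDiff_superposition hρ').comp (contDiff_id.smul contDiff_const)
  refine ⟨fun y => primitive (D y) one, ?_, fun y => ?_, ?_⟩
  · exact ((contDiff_eval one).comp contDiff_primitive).comp hD
  · have h := primitive_eq_of_hasDerivAt (f := fun s => ρ (y * s)) (y • D y) (fun s => ?_) one
    · rw [map_smul] at h
      simpa [one, h0] using h.symm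
    · have h1 : HasDerivAt (fun s : ℝ => y * s) y (s : ℝ) := by
        simpa using (hasDerivAt_id (s : ℝ)).const_mul y
      have h2 : HasDerivAt (fun s : ℝ => ρ (y * s)) (deriv ρ (y * s) * y) (s : ℝ) :=
        ((hρ.differentiable (by simp)) (y * s)).hasDerivAt.comp (s : ℝ) h1
      simpa [D, idK, mul_comm] using h2
  · have : D 0 = ContinuousMap.const _ (deriv ρ 0) := by
      ext s
      simp [D]
    change primitive (D 0) one = _
    rw [this, primitive_const]
    simp [one]

end Calculus

/-! ### Smooth dependence of solutions on the data -/

section Flow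

/-- The acceleration `g t - f (x, y)` as a function of the time, the position and the velocity. -/
def acceleration (f : ℝ → ℝ → ℝ) (g : ℝ → ℝ) (z : ℝ × ℝ × ℝ) : ℝ := g z.1 - f z.2.1 z.2.2

/-- The autonomous vector field on (time, position, velocity) of the equation
`x'' + f (x, x') = g t`. -/
def vectorField (f : ℝ → ℝ → ℝ) (g : ℝ → ℝ) (z : ℝ × ℝ × ℝ) : ℝ × ℝ × ℝ :=
  (1, z.2.2, acceleration f g z)

variable {f : ℝ → ℝ → ℝ} {g : ℝ → ℝ}

lemma contDiff_acceleration (hf : ContDiff ℝ ∞ (Function.uncurry f)) (hg : ContDiff ℝ ∞ g) :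
    ContDiff ℝ ∞ (acceleration f g) :=
  (hg.comp contDiff_fst).sub (hf.comp (contDiff_snd.fst.prodMk contDiff_snd.snd))

lemma contDiff_vectorField (hf : ContDiff ℝ ∞ (Function.uncurry f)) (hg : ContDiff ℝ ∞ g) :
    ContDiff ℝ ∞ (vectorField f g) :=
  contDiff_const.prodMk (contDiff_snd.snd.prodMk (contDiff_acceleration hf hg))

/-- A solution `u` of the integral equation in the rescaled time `s` is a solution of the impact
oscillator at the times `τ + t s`. -/
lemma stateAt_of_eq_primitive (hV : Continuous (vectorField f g)) {c τ v t : ℝ} (ht : t ≠ 0)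
    {u : C(Icc (-2 : ℝ) 2, ℝ × ℝ × ℝ)}
    (hu : u = constCLM _ _ (τ, c, v) + t • primitive (superposition (vectorField f g) hV u))
    (s : Icc (-2 : ℝ) 2) (hs : |(s : ℝ)| < 2) :
    StateAt f g c τ v (t * s) (u s).2.1 (u s).2.2 := by
  set z : ℝ → ℝ × ℝ × ℝ := IccExtend (by norm_num : (-2 : ℝ) ≤ 2) u with hz
  have hzu : ∀ s : Icc (-2 : ℝ) 2, z s = u s := fun s => IccExtend_val _ _ s
  have hpt : ∀ s, u s = (τ, c, v) + t • primitive (superposition (vectorField f g) hV u) s :=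
    fun s => by
      conv_lhs => rw [hu]
      simp
  have hz0 : z 0 = (τ, c, v) := by
    have h := hzu ⟨0, by norm_num⟩
    rw [hpt, primitive_apply] at h
    simpa using h
  have hzd : ∀ s ∈ Ioo (-2 : ℝ) 2, HasDerivAt z (t • vectorField f g (z s)) s := fun s hs => by
    have h := ((hasDerivAt_primitive (superposition (vectorField f g) hV u) s hs).const_smul
      t).const_add ((τ, c, v) : ℝ × ℝ × ℝ)
    exact h.congr_of_eventuallyEq (Eventually.of_forall fun s => hpt _)
  have hz1 : ∀ s : Icc (-2 : ℝ) 2, (u s).1 = τ + t * s := fun s => by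
    rw [hpt]
    have h := clm_primitive (ContinuousLinearMap.fst ℝ ℝ (ℝ × ℝ))
      (superposition (vectorField f g) hV u) s
    have h2 : (ContinuousLinearMap.fst ℝ ℝ (ℝ × ℝ)).compLeftContinuous ℝ _
        (superposition (vectorField f g) hV u) = ContinuousMap.const _ 1 := rfl
    rw [h2, primitive_const] at h
    simp only [ContinuousLinearMap.coe_fst'] at h
    simp [h]
  have hI : ∀ r ∈ Metric.ball τ (2 * |t|), (r - τ) / t ∈ Ioo (-2 : ℝ) 2 := fun r hr => by
    rw [mem_Ioo, ← abs_lt, abs_div, div_lt_iff₀ (abs_pos.2 ht)]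
    simpa [Real.dist_eq] using hr
  have hd : ∀ r ∈ Metric.ball τ (2 * |t|),
      HasDerivAt (fun r => z ((r - τ) / t)) (vectorField f g (z ((r - τ) / t))) r := fun r hr => by
    have h1 : HasDerivAt (fun r => (r - τ) / t) t⁻¹ r := by
      simpa using ((hasDerivAt_id r).sub_const τ).div_const t
    have h2 := (hzd _ (hI r hr)).scomp r h1
    rwa [smul_smul, inv_mul_cancel₀ ht, one_smul] at h2
  have htime : ∀ r ∈ Metric.ball τ (2 * |t|), (z ((r - τ) / t)).1 = r := fun r hr => by
    have h := hz1 ⟨_, Ioo_subset_Icc_self (hI r hr)⟩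
    rw [← hzu] at h
    rw [h]
    field_simp
    ring
  have hts : (τ + t * s - τ) / t = s := by field_simp; ring
  refine ⟨Metric.ball τ (2 * |t|), fun r => (z ((r - τ) / t)).2.1, fun r => (z ((r - τ) / t)).2.2,
    ⟨Metric.isOpen_ball, ?_, fun r hr => (hd r hr).snd.fst, fun r hr => ?_⟩,
    Metric.mem_ball_self (by positivity), ?_, ?_, ?_, ?_, ?_⟩
  · rw [Real.ball_eq_Ioo]
    exact ordConnected_Ioo
  · have h := (hd r hr).snd.snd
    have h2 := htime r hr
    simp only [vectorField, acceleration, h2] at h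
    exact h
  · rw [Metric.mem_ball, Real.dist_eq, add_sub_cancel_left, abs_mul, mul_comm]
    exact mul_lt_mul_of_pos_right hs (abs_pos.2 ht)
  · simp [hz0]
  · simp [hz0]
  · simp only [hts, hzu]
  · simp only [hts, hzu]

/-- The position and the velocity at time `τ + t` of the solution started from `(c, v)` at time `τ`
are `c + t v + t² M` and `v + t N` with `M` and `N` smooth in `(t, τ, v)` near `(0, τ₀, 0)`.

In the rescaled time the solution is a zero `u` of a smooth map on `C([-2, 2], ℝ³)` in which `t` is
a parameter. That map is `u - const` at `t = 0`, so that the implicit function theorem applies, and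
`M`, `N` are iterated integrals of the acceleration along `u`. -/
theorem exists_flow_expansion (hf : ContDiff ℝ ∞ (Function.uncurry f)) (hg : ContDiff ℝ ∞ g)
    (c τ₀ : ℝ) : ∃ M N : ℝ × ℝ × ℝ → ℝ,
      M (0, τ₀, 0) = initialAcceleration f g c τ₀ / 2 ∧
      N (0, τ₀, 0) = initialAcceleration f g c τ₀ ∧
      ∀ᶠ p in 𝓝 ((0, τ₀, 0) : ℝ × ℝ × ℝ), ContDiffAt ℝ ∞ M p ∧ ContDiffAt ℝ ∞ N p ∧
        StateAt f g c p.2.1 p.2.2 p.1 (c + p.1 * (p.2.2 + p.1 * M p)) (p.2.2 + p.1 * N p) := by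
  have hV := contDiff_vectorField hf hg
  have hW := contDiff_acceleration hf hg
  let F : (ℝ × ℝ × ℝ) × C(Icc (-2 : ℝ) 2, ℝ × ℝ × ℝ) → C(Icc (-2 : ℝ) 2, ℝ × ℝ × ℝ) :=
    fun z => z.2 - constCLM _ _ (z.1.2.1, c, z.1.2.2) -
      z.1.1 • primitive (superposition (vectorField f g) hV.continuous z.2)
  have hF : ContDiff ℝ ∞ F := by
    have h1 : ContDiff ℝ ∞ fun z : (ℝ × ℝ × ℝ) × C(Icc (-2 : ℝ) 2, ℝ × ℝ × ℝ) =>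
        ((z.1.2.1, c, z.1.2.2) : ℝ × ℝ × ℝ) :=
      contDiff_fst.snd.fst.prodMk (contDiff_const.prodMk contDiff_fst.snd.snd)
    have h2 : ContDiff ℝ ∞ fun z : (ℝ × ℝ × ℝ) × C(Icc (-2 : ℝ) 2, ℝ × ℝ × ℝ) =>
        constCLM (Icc (-2 : ℝ) 2) (ℝ × ℝ × ℝ) (z.1.2.1, c, z.1.2.2) :=
      contDiff_constCLM.comp h1
    have h3 : ContDiff ℝ ∞ fun z : (ℝ × ℝ × ℝ) × C(Icc (-2 : ℝ) 2, ℝ × ℝ × ℝ) =>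
        superposition (vectorField f g) hV.continuous z.2 :=
      (contDiff_superposition hV).comp contDiff_snd
    have h4 : ContDiff ℝ ∞ fun z : (ℝ × ℝ × ℝ) × C(Icc (-2 : ℝ) 2, ℝ × ℝ × ℝ) =>
        primitive (superposition (vectorField f g) hV.continuous z.2) :=
      contDiff_primitive.comp h3
    exact (contDiff_snd.sub h2).sub (contDiff_fst.fst.smul h4)
  -- at `t = 0` the equation is trivial
  have hF0 : ∀ u, F ((0, τ₀, 0), u) = u - constCLM _ _ (τ₀, c, 0) := fun u => by simp [F]
  obtain ⟨S, hS0, hS⟩ := exists_contDiffAt_implicit (F := F) (p₀ := (0, τ₀, 0))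
    (x₀ := constCLM _ _ (τ₀, c, 0)) (Eventually.of_forall fun z => hF.contDiffAt) (by simp [hF0])
    (ContinuousLinearEquiv.refl ℝ _) (by
      simp only [hF0]
      exact (hasFDerivAt_id _).sub_const _)
  let one : Icc (-2 : ℝ) 2 := ⟨1, by norm_num⟩
  let A : ℝ × ℝ × ℝ → C(Icc (-2 : ℝ) 2, ℝ) :=
    fun p => superposition (acceleration f g) hW.continuous (S p)
  have hA0 : A (0, τ₀, 0) = ContinuousMap.const _ (initialAcceleration f g c τ₀) := by
    ext s
    simp [A, hS0, acceleration, initialAcceleration]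
  refine ⟨fun p => primitive (primitive (A p)) one, fun p => primitive (A p) one, ?_, ?_, ?_⟩
  · simp only [hA0]
    rw [primitive_eq_of_hasDerivAt (f := fun s => s ^ 2 / 2 * initialAcceleration f g c τ₀)]
    · simp [one]; ring
    · intro s
      rw [primitive_const]
      have := (((hasDerivAt_id (s : ℝ)).pow 2).div_const 2).mul_const
        (initialAcceleration f g c τ₀)
      simpa using this
  · simp only [hA0]
    rw [primitive_const]
    simp [one]
  obtain ⟨ε, hε, H⟩ := Metric.eventually_nhds_iff_ball.1 hS
  filter_upwards [Metric.ball_mem_nhds _ hε] with p hp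
  have hSp := (H p hp).1
  have hAp : ContDiffAt ℝ ∞ A p := (contDiff_superposition hW).contDiffAt.comp p hSp
  have hI : ContDiffAt ℝ ∞ (fun p => primitive (A p)) p := contDiff_primitive.contDiffAt.comp p hAp
  refine ⟨(contDiff_eval one).contDiffAt.comp p
    (contDiff_primitive.contDiffAt.comp p hI),
    (contDiff_eval one).contDiffAt.comp p hI, ?_⟩
  have hsol : ∀ q ∈ Metric.ball ((0, τ₀, 0) : ℝ × ℝ × ℝ) ε, S q = constCLM _ _ (q.2.1, c, q.2.2) +
      q.1 • primitive (superposition (vectorField f g) hV.continuous (S q)) := fun q hq => by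
    have h := (H q hq).2
    simp only [F] at h
    rwa [sub_sub, sub_eq_zero] at h
  obtain ⟨t, τ, v⟩ := p
  rcases eq_or_ne t 0 with rfl | ht
  · -- the state at time zero, read off from the solution for some nonzero time
    have hq : ((ε / 2, τ, v) : ℝ × ℝ × ℝ) ∈ Metric.ball ((0, τ₀, 0) : ℝ × ℝ × ℝ) ε := by
      rw [Metric.mem_ball, Prod.dist_eq] at hp ⊢
      refine max_lt ?_ ((le_max_right _ _).trans_lt hp)
      rw [Real.dist_eq, sub_zero, abs_of_pos (by positivity)]
      linarith
    obtain ⟨I, x, y, h, h1, h2, h3, h4, -⟩ :=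
      stateAt_of_eq_primitive hV.continuous (by positivity) (hsol _ hq) one (by norm_num [one])
    exact ⟨I, x, y, h, h1, by simpa using h1, h3, h4, by simpa using h3, by simpa using h4⟩
  · have h := stateAt_of_eq_primitive hV.continuous ht (hsol _ hp) one (by norm_num [one])
    let px : ℝ × ℝ × ℝ →L[ℝ] ℝ :=
      ContinuousLinearMap.fst ℝ ℝ ℝ ∘L ContinuousLinearMap.snd ℝ ℝ (ℝ × ℝ)
    let py : ℝ × ℝ × ℝ →L[ℝ] ℝ :=
      ContinuousLinearMap.snd ℝ ℝ ℝ ∘L ContinuousLinearMap.snd ℝ ℝ (ℝ × ℝ)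
    let VS := superposition (vectorField f g) hV.continuous (S (t, τ, v))
    have hy : py.compLeftContinuous ℝ _ (S (t, τ, v)) =
        constCLM _ _ v + t • primitive (A (t, τ, v)) := by
      ext s
      have h1 := congrArg (fun u => (u s).2.2) (hsol _ hp)
      have h2 : (primitive VS s).2.2 = _ := clm_primitive py VS s
      simp only [ContinuousMap.add_apply, ContinuousMap.smul_apply, constCLM_apply, Prod.snd_add,
        Prod.smul_snd] at h1
      rw [h2] at h1
      exact h1
    have hx := congrArg (fun u => (u one).2.1) (hsol _ hp)
    have hx2 : (primitive VS one).2.1 = primitive (py.compLeftContinuous ℝ _ (S (t, τ, v))) one :=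
      clm_primitive px VS one
    simp only [ContinuousMap.add_apply, ContinuousMap.smul_apply, constCLM_apply, Prod.snd_add,
      Prod.smul_snd, Prod.fst_add, Prod.smul_fst] at hx
    have hvI : primitive (constCLM (Icc (-2 : ℝ) 2) ℝ v) one = v :=
      (primitive_const v one).trans (one_mul v)
    rw [hx2, hy, map_add, map_smul, ContinuousMap.add_apply, ContinuousMap.smul_apply, hvI] at hx
    have hy1 := congrArg (fun u => u one) hy
    simp only [smul_eq_mul] at hx
    rw [hx] at h
    have hy2 : (S (t, τ, v) one).2.2 = v + t * primitive (A (t, τ, v)) one := hy1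
    rw [hy2] at h
    simpa [one] using h

end Flow

/-! ### Normal form of the impact map -/

section NormalForm

/-- Where the initial acceleration `a` is negative, the impact map is
`(τ, v) ↦ (τ + v α (τ, v), v β (τ, v))` with smooth `α`, `β`, near `(τ₀, 0)`.

The time of flight `θ` solves `v + θ M (θ, τ, v) = 0` with `M (0, τ₀, 0) = a / 2 ≠ 0`. The mean
velocity `v + t M` is strictly decreasing in `t`, so that `θ` is the first impact. For `v = 0` the
position is `c + t² M < c`: there is no lift-off, the impact map fixes `(τ, 0)`, and `θ = 0`
again. -/
theorem exists_impactStep_normalForm {f : ℝ → ℝ → ℝ} {g ρ : ℝ → ℝ} {c τ₀ : ℝ}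
    (hf : ContDiff ℝ ∞ (Function.uncurry f)) (hg : ContDiff ℝ ∞ g) (hρ : ContDiff ℝ ∞ ρ)
    (hρ0 : ρ 0 = 0) (ha : initialAcceleration f g c τ₀ < 0) :
    ∃ α β : ℝ × ℝ → ℝ, ContDiff ℝ ∞ α ∧ ContDiff ℝ ∞ β ∧
      α (τ₀, 0) = -2 / initialAcceleration f g c τ₀ ∧ β (τ₀, 0) = -deriv ρ 0 ∧
      ∀ᶠ p in 𝓝 ((τ₀, 0) : ℝ × ℝ),
        ImpactStep f g c ρ p (p.1 + p.2 * α p, p.2 * β p) := by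
  obtain ⟨M, N, hM0, hN0, hMN⟩ := exists_flow_expansion hf hg c τ₀
  obtain ⟨κ, hκ, hκρ, hκ0⟩ := exists_contDiff_eq_mul hρ hρ0
  set a := initialAcceleration f g c τ₀ with ha_def
  let E : ℝ × ℝ × ℝ → ℝ := fun q => q.2.2 + q.1 * M q
  have hMs : ∀ᶠ q in 𝓝 ((0, τ₀, 0) : ℝ × ℝ × ℝ), ContDiffAt ℝ ∞ M q := hMN.mono fun q h => h.1
  have hEs : ∀ᶠ q in 𝓝 ((0, τ₀, 0) : ℝ × ℝ × ℝ), ContDiffAt ℝ ∞ E q := hMs.mono fun q h =>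
    contDiff_snd.snd.contDiffAt.add (contDiff_fst.contDiffAt.mul h)
  have hline : ∀ q : ℝ × ℝ × ℝ, HasDerivAt (fun t : ℝ => (t, q.2)) (1, 0) q.1 := fun q =>
    (hasDerivAt_id q.1).prodMk (hasDerivAt_const _ _)
  have hEd : ∀ q : ℝ × ℝ × ℝ, ContDiffAt ℝ ∞ E q →
      HasDerivAt (fun t => E (t, q.2)) (fderiv ℝ E q (1, 0)) q.1 := fun q hq =>
    HasFDerivAt.comp_hasDerivAt (f := fun t : ℝ => (t, q.2)) q.1
      ((hq.differentiableAt (by simp)).hasFDerivAt) (hline q)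
  have hE0 : HasDerivAt (fun t => E (t, (τ₀, 0))) (a / 2) 0 := by
    have h1 := ((hMs.self_of_nhds.differentiableAt (by simp)).hasFDerivAt).comp_hasDerivAt
      (f := fun t : ℝ => (t, ((τ₀, 0) : ℝ × ℝ))) 0 (hline (0, τ₀, 0))
    have h2 := ((hasDerivAt_id (0 : ℝ)).mul h1).const_add (0 : ℝ)
    simpa [hM0, E] using h2
  have hEneg : ∀ᶠ q in 𝓝 ((0, τ₀, 0) : ℝ × ℝ × ℝ), fderiv ℝ E q (1, 0) < 0 := by
    have h := hEs.self_of_nhds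
    have hc : ContinuousAt (fun q => fderiv ℝ E q (1, 0)) (0, τ₀, 0) :=
      (h.continuousAt_fderiv (by simp)).clm_apply continuousAt_const
    refine hc.eventually_lt continuousAt_const ?_
    rw [(hEd _ h).unique hE0]
    linarith
  have hMneg : ∀ᶠ q in 𝓝 ((0, τ₀, 0) : ℝ × ℝ × ℝ), M q < 0 :=
    hMs.self_of_nhds.continuousAt.eventually_lt continuousAt_const (by rw [hM0]; linarith)
  have hswap : Tendsto (fun z : (ℝ × ℝ) × ℝ => ((z.2, z.1) : ℝ × ℝ × ℝ)) (𝓝 ((τ₀, 0), 0))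
      (𝓝 (0, τ₀, 0)) := (continuous_snd.prodMk continuous_fst).tendsto _
  obtain ⟨θ, hθ0, hθ⟩ := exists_contDiffAt_implicit (F := fun z : (ℝ × ℝ) × ℝ => E (z.2, z.1))
    (p₀ := (τ₀, 0)) (x₀ := 0)
    (by
      filter_upwards [hswap.eventually hEs] with z hz
      exact ContDiffAt.comp (g := E) z hz (contDiff_snd.prodMk contDiff_fst).contDiffAt)
    (by simp [E]) _ (hE0.hasFDerivAt_equiv (by linarith))
  have hθt : Tendsto (fun p => (θ p, p)) (𝓝 ((τ₀, 0) : ℝ × ℝ)) (𝓝 (0, τ₀, 0)) := by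
    have h := hθ.self_of_nhds.1.continuousAt
    rw [ContinuousAt, hθ0] at h
    exact h.prodMk_nhds tendsto_id
  let α₀ : ℝ × ℝ → ℝ := fun p => -(M (θ p, p))⁻¹
  let β₀ : ℝ × ℝ → ℝ := fun p => (1 + α₀ p * N (θ p, p)) * κ (p.2 + θ p * N (θ p, p))
  have hαs : ∀ᶠ p in 𝓝 ((τ₀, 0) : ℝ × ℝ), ContDiffAt ℝ ∞ α₀ p := by
    filter_upwards [hθ, hθt.eventually hMs, hθt.eventually hMneg] with p h1 h2 h3
    exact ((ContDiffAt.comp (g := M) (f := fun p => (θ p, p)) p h2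
      (h1.1.prodMk contDiffAt_id)).inv h3.ne).neg
  have hβs : ∀ᶠ p in 𝓝 ((τ₀, 0) : ℝ × ℝ), ContDiffAt ℝ ∞ β₀ p := by
    filter_upwards [hθ, hθt.eventually hMN, hαs] with p h1 h2 h3
    have hN : ContDiffAt ℝ ∞ (fun p => N (θ p, p)) p :=
      ContDiffAt.comp (g := N) (f := fun p => (θ p, p)) p h2.2.1
        (h1.1.prodMk contDiffAt_id)
    exact (contDiffAt_const.add (h3.mul hN)).mul
      (hκ.contDiffAt.comp p (contDiff_snd.contDiffAt.add (h1.1.mul hN)))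
  obtain ⟨α, hα, hαα⟩ := exists_contDiff_eventuallyEq hαs
  obtain ⟨β, hβ, hββ⟩ := exists_contDiff_eventuallyEq hβs
  have hα0 : α₀ (τ₀, 0) = -2 / a := by
    simp only [α₀, hθ0, hM0]
    rw [inv_div, neg_div]
  refine ⟨α, β, hα, hβ, hαα.self_of_nhds.trans hα0, hββ.self_of_nhds.trans ?_, ?_⟩
  · simp only [β₀, hα0, hθ0, hN0, zero_mul, add_zero, hκ0]
    have : a ≠ 0 := ha.ne
    field_simp
    ring
  obtain ⟨ε, hε, H⟩ := Metric.eventually_nhds_iff_ball.1 (hMN.and (hEs.and (hEneg.and hMneg)))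
  filter_upwards [hαα, hββ, hθ, hθt.eventually (Metric.ball_mem_nhds _ hε)] with p h1 h2 h3 h4
  obtain ⟨τ, v⟩ := p
  set t := θ (τ, v) with ht
  rw [h1, h2]
  have hball : ∀ s : ℝ, |s| < ε → (s, τ, v) ∈ Metric.ball ((0, τ₀, 0) : ℝ × ℝ × ℝ) ε :=
    fun s hs => by
      rw [Prod.dist_eq] at h4
      rw [Metric.mem_ball, Prod.dist_eq]
      refine max_lt ?_ ((le_max_right _ _).trans_lt h4)
      rwa [Real.dist_eq, sub_zero]
  have htε : |t| < ε := by
    have := (le_max_left _ _).trans_lt (Prod.dist_eq.symm.trans_lt h4)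
    rwa [Real.dist_eq, sub_zero] at this
  have hEt : v + t * M (t, τ, v) = 0 := h3.2
  have htv : t = v * α₀ (τ, v) := by
    have := (H _ h4).2.2.2.ne
    simp only [α₀]
    rw [← ht]
    field_simp
    linarith
  have hα_pos : 0 < α₀ (τ, v) := neg_pos.2 (inv_lt_zero.2 (H _ h4).2.2.2)
  have hstate : StateAt f g c τ v t c (v + t * N (t, τ, v)) := by
    have h := (H _ h4).1.2.2
    simp only [hEt, mul_zero, add_zero] at h
    exact h
  -- there is no impact at a nonzero time before `t`
  have hanti : StrictAntiOn (fun s => E (s, τ, v)) (Ioo (-ε) ε) := by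
    have hd : ∀ s ∈ Ioo (-ε) ε, HasDerivAt (fun s => E (s, τ, v))
        (fderiv ℝ E (s, τ, v) (1, 0)) s := fun s hs =>
      hEd (s, τ, v) (H _ (hball s (abs_lt.2 hs))).2.1
    refine strictAntiOn_of_deriv_neg (convex_Ioo _ _)
      (fun s hs => (hd s hs).continuousAt.continuousWithinAt) fun s hs => ?_
    rw [interior_Ioo] at hs
    rw [(hd s hs).deriv]
    exact (H _ (hball s (abs_lt.2 hs))).2.2.1
  have hno : ∀ s : ℝ, |s| < ε → s ≠ 0 → s ≠ t → (τ, v, s) ∉ impactSurface f g c := by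
    rintro s hs hs0 hst ⟨u, hu⟩
    have h := ((H _ (hball s hs)).1.2.2.unique hf hg hu).1
    have h' : E (s, τ, v) = E (t, τ, v) := by
      simp only [E, hEt]
      have : s * (v + s * M (s, τ, v)) = 0 := by simpa using h
      exact (mul_eq_zero.1 this).resolve_left hs0
    exact hst (hanti.injOn (abs_lt.1 hs) (abs_lt.1 htε) h')
  refine ⟨t, (τ + t, v + t * N (t, τ, v)), ⟨⟨_, hstate⟩, ?_⟩, ⟨_, hstate, rfl⟩, ?_⟩
  · rcases lt_trichotomy v 0 with hv | hv | hv
    · have ht0 : t < 0 := by rw [htv]; exact mul_neg_of_neg_of_pos hv hα_pos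
      refine Or.inr (Or.inl ⟨hv, ht0, fun s hs => hno s ?_ hs.2.ne hs.1.ne'⟩)
      rw [abs_of_neg ht0] at htε
      rw [abs_of_neg hs.2]
      linarith [hs.1]
    · refine Or.inr (Or.inr ⟨hv, fun hl => ?_, by rw [htv]; simp [hv]⟩)
      obtain ⟨s, ⟨b, u, hs, hb⟩, hs0, hsε⟩ := (hl.and (Ioo_mem_nhdsGT hε)).exists
      have hq := H _ (hball s (by rwa [abs_of_pos hs0]))
      have h := (hq.1.2.2.unique hf hg (by simpa [hv] using hs)).1
      simp only [hv, zero_add] at h hq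
      nlinarith [mul_pos (mul_pos hs0 hs0) (neg_pos.2 hq.2.2.2)]
    · have ht0 : 0 < t := by rw [htv]; exact mul_pos hv hα_pos
      refine Or.inl ⟨Or.inl hv, ht0, fun s hs => hno s ?_ hs.1.ne' hs.2.ne⟩
      rw [abs_of_pos ht0] at htε
      rw [abs_of_pos hs.1]
      linarith [hs.2]
  · simp only [restitution, Prod.mk.injEq]
    refine ⟨by rw [← htv], ?_⟩
    rw [hκρ]
    simp only [β₀, ← ht]
    have : v + t * N (t, τ, v) = v * (1 + α₀ (τ, v) * N (t, τ, v)) := by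
      linear_combination N (t, τ, v) * htv
    rw [← mul_assoc, ← this]

end NormalForm

/-! ### Orbits converging to a fixed point -/

section Sequences

/-- A convergent sequence, as a continuous function on the one-point compactification of `ℕ`. -/
def ofSeq {Y : Type} [TopologicalSpace Y] (s : ℕ → Y) (y : Y) (h : Tendsto s atTop (𝓝 y)) :
    C(OnePoint ℕ, Y) :=
  OnePoint.continuousMapMkNat s y h

@[simp] lemma ofSeq_coe {Y : Type} [TopologicalSpace Y] (s : ℕ → Y) (y : Y)
    (h : Tendsto s atTop (𝓝 y)) (n : ℕ) : ofSeq s y h (n : OnePoint ℕ) = s n := rfl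

@[simp] lemma ofSeq_infty {Y : Type} [TopologicalSpace Y] (s : ℕ → Y) (y : Y)
    (h : Tendsto s atTop (𝓝 y)) : ofSeq s y h OnePoint.infty = y := rfl

lemma tendsto_coe_onePoint {Y : Type} [TopologicalSpace Y] (u : C(OnePoint ℕ, Y)) :
    Tendsto (fun n : ℕ => u n) atTop (𝓝 (u OnePoint.infty)) :=
  (OnePoint.continuous_iff_from_nat u).1 u.continuous

lemma tendsto_natCast_infty : Tendsto (fun n : ℕ => (n : OnePoint ℕ)) atTop (𝓝 OnePoint.infty) :=
  tendsto_coe_onePoint (ContinuousMap.id (OnePoint ℕ))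

/-- The left shift `(u₀, u₁, …) ↦ (u₁, u₂, …)` on convergent sequences. -/
noncomputable def leftShift : C(OnePoint ℕ, ℝ) →L[ℝ] C(OnePoint ℕ, ℝ) :=
  ContinuousMap.compCLM ℝ ℝ (ofSeq (fun n : ℕ => ((n + 1 : ℕ) : OnePoint ℕ)) OnePoint.infty
    (tendsto_natCast_infty.comp (tendsto_add_atTop_nat 1)))

/-- The sequence `(1, 0, 0, …)`. -/
noncomputable def seqSingle : C(OnePoint ℕ, ℝ) :=
  ofSeq (fun n => if n = 0 then 1 else 0) 0
    (tendsto_const_nhds.congr' ((eventually_ne_atTop 0).mono fun n hn => by simp [hn]))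

/-- The right shift `(u₀, u₁, …) ↦ (0, u₀, u₁, …)` on convergent sequences. -/
noncomputable def rightShift : C(OnePoint ℕ, ℝ) →L[ℝ] C(OnePoint ℕ, ℝ) :=
  ContinuousLinearMap.mul ℝ C(OnePoint ℕ, ℝ) (1 - seqSingle) ∘L
    ContinuousMap.compCLM ℝ ℝ (ofSeq (fun n : ℕ => ((n - 1 : ℕ) : OnePoint ℕ)) OnePoint.infty
      (tendsto_natCast_infty.comp (tendsto_sub_atTop_nat 1)))

@[simp] lemma leftShift_coe (u : C(OnePoint ℕ, ℝ)) (n : ℕ) :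
    leftShift u n = u ((n + 1 : ℕ) : OnePoint ℕ) := rfl

@[simp] lemma rightShift_zero (u : C(OnePoint ℕ, ℝ)) :
    rightShift u ((0 : ℕ) : OnePoint ℕ) = 0 := by
  simp [rightShift, seqSingle]

@[simp] lemma rightShift_succ (u : C(OnePoint ℕ, ℝ)) (n : ℕ) :
    rightShift u ((n + 1 : ℕ) : OnePoint ℕ) = u n := by
  simp [rightShift, seqSingle]

lemma norm_leftShift_le : ‖leftShift‖ ≤ 1 :=
  leftShift.opNorm_le_bound zero_le_one fun u => by
    rw [one_mul, ContinuousMap.norm_le _ (norm_nonneg u)]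
    exact fun k => u.norm_coe_le_norm _

lemma norm_rightShift_le : ‖rightShift‖ ≤ 1 :=
  rightShift.opNorm_le_bound zero_le_one fun u => by
    rw [one_mul, ContinuousMap.norm_le _ (norm_nonneg u)]
    intro k
    induction k using OnePoint.rec with
    | infty => simpa [rightShift, seqSingle] using u.norm_coe_le_norm OnePoint.infty
    | coe n =>
      rcases n with _ | n
      · rw [rightShift_zero, norm_zero]
        exact norm_nonneg u
      · rw [rightShift_succ]
        exact u.norm_coe_le_norm _

variable {K E F : Type} [TopologicalSpace K] [CompactSpace K]
  [NormedAddCommGroup E] [NormedSpace ℝ E] [NormedAddCommGroup F] [NormedSpace ℝ F]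

lemma contDiff_compLeft (L : E →L[ℝ] F) :
    ContDiff ℝ ∞ (fun u : C(K, E) => L.compLeftContinuous ℝ K u) :=
  (L.compLeftContinuous ℝ K : C(K, E) →L[ℝ] C(K, F)).contDiff

/-- The operator `1 - T` for `‖T‖ < 1`, as a continuous linear equivalence. -/
noncomputable def oneSubEquiv [CompleteSpace E] (T : E →L[ℝ] E) (hT : ‖T‖ < 1) : E ≃L[ℝ] E :=
  ContinuousLinearEquiv.unitsEquiv ℝ E (Units.oneSub T hT)

@[simp] lemma oneSubEquiv_apply [CompleteSpace E] (T : E →L[ℝ] E) (hT : ‖T‖ < 1) (x : E) :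
    oneSubEquiv T hT x = x - T x := rfl

/-- Solvability of the pair of equations `w = v d + q⁻¹ R (w B)`, `e = q S e - w A` for `(w, e)`,
where `S` and `R` have norm at most `1`. The linearization at `w = e = 0` is triangular, with the
diagonal entries `1 - (r / q) R` and `1 - q S`, which are invertible because `r < q < 1`. -/
theorem exists_contDiffAt_fixedPair {X : Type} [NormedCommRing X] [NormedAlgebra ℝ X]
    [CompleteSpace X] {S R : X →L[ℝ] X} (hS : ‖S‖ ≤ 1) (hR : ‖R‖ ≤ 1) (d : X)
    {A B : (ℝ × ℝ) × (X × X) → X} (hA : ContDiff ℝ ∞ A) (hB : ContDiff ℝ ∞ B) {τ₀ a r q : ℝ}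
    (hr0 : 0 < r) (hrq : r < q) (hq1 : q < 1) (hA0 : A ((τ₀, 0), 0) = algebraMap ℝ X a)
    (hB0 : B ((τ₀, 0), 0) = algebraMap ℝ X r) :
    ∃ φ : ℝ × ℝ → X × X, φ (τ₀, 0) = 0 ∧ ∀ᶠ p in 𝓝 ((τ₀, 0) : ℝ × ℝ), ContDiffAt ℝ ∞ φ p ∧
      (φ p).1 = p.2 • d + q⁻¹ • R ((φ p).1 * B (p, φ p)) ∧
      (φ p).2 = q • S (φ p).2 - (φ p).1 * A (p, φ p) := by
  have hq0 : 0 < q := hr0.trans hrq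
  let Ψ : (ℝ × ℝ) × (X × X) → X × X := fun x =>
    (x.2.1 - x.1.2 • d - q⁻¹ • R (x.2.1 * B x), x.2.2 - q • S x.2.2 + x.2.1 * A x)
  have hΨ : ContDiff ℝ ∞ Ψ := by
    have h1 : ContDiff ℝ ∞ fun x : (ℝ × ℝ) × (X × X) => x.2.1 * B x := contDiff_snd.fst.mul hB
    have h2 : ContDiff ℝ ∞ fun x : (ℝ × ℝ) × (X × X) => x.2.1 * A x := contDiff_snd.fst.mul hA
    have h3 : ContDiff ℝ ∞ fun x : (ℝ × ℝ) × (X × X) => R (x.2.1 * B x) := R.contDiff.comp h1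
    have h4 : ContDiff ℝ ∞ fun x : (ℝ × ℝ) × (X × X) => S x.2.2 :=
      S.contDiff.comp contDiff_snd.snd
    have h5 : ContDiff ℝ ∞ fun x : (ℝ × ℝ) × (X × X) => x.1.2 • d :=
      contDiff_fst.snd.smul contDiff_const
    exact ((contDiff_snd.fst.sub h5).sub (h3.const_smul q⁻¹)).prodMk
      ((contDiff_snd.snd.sub (h4.const_smul q)).add h2)
  have hR' : ‖(r / q) • R‖ < 1 := by
    rw [norm_smul, Real.norm_of_nonneg (by positivity)]
    exact (mul_le_of_le_one_right (by positivity) hR).trans_lt ((div_lt_one hq0).2 hrq)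
  have hS' : ‖q • S‖ < 1 := by
    rw [norm_smul, Real.norm_of_nonneg hq0.le]
    exact (mul_le_of_le_one_right hq0.le hS).trans_lt hq1
  have hderiv : HasFDerivAt (fun y => Ψ ((τ₀, 0), y))
      (((oneSubEquiv _ hR').skewProd (oneSubEquiv _ hS') (a • ContinuousLinearMap.id ℝ X) :
        (X × X) ≃L[ℝ] (X × X)) : (X × X) →L[ℝ] (X × X)) 0 := by
    have hpart : HasFDerivAt (fun y : X × X => (((τ₀, 0), y) : (ℝ × ℝ) × (X × X)))
        (ContinuousLinearMap.inr ℝ _ _) 0 := hasFDerivAt_prodMk_right _ _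
    have hA1 : HasFDerivAt (fun y => A ((τ₀, 0), y)) _ 0 :=
      ((hA.differentiable (by simp) ((τ₀, 0), 0)).hasFDerivAt).comp 0 hpart
    have hB1 : HasFDerivAt (fun y => B ((τ₀, 0), y)) _ 0 :=
      ((hB.differentiable (by simp) ((τ₀, 0), 0)).hasFDerivAt).comp 0 hpart
    have hw : HasFDerivAt (fun y : X × X => y.1) (ContinuousLinearMap.fst ℝ X X) 0 :=
      hasFDerivAt_fst
    have he : HasFDerivAt (fun y : X × X => y.2) (ContinuousLinearMap.snd ℝ X X) 0 :=
      hasFDerivAt_snd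
    have h1 := (hw.sub_const ((0 : ℝ) • d)).sub
      ((R.hasFDerivAt.comp 0 (hw.mul hB1)).const_smul q⁻¹)
    have h2 := (he.sub ((S.hasFDerivAt.comp 0 he).const_smul q)).add (hw.mul hA1)
    refine (h1.prodMk h2).congr_fderiv ?_
    ext y <;> simp [hA0, hB0, div_eq_inv_mul, mul_smul, Algebra.algebraMap_eq_smul_one]
  obtain ⟨φ, hφ0, hφ⟩ := exists_contDiffAt_implicit (F := Ψ) (p₀ := (τ₀, 0)) (x₀ := 0)
    (Eventually.of_forall fun x => hΨ.contDiffAt) (by simp [Ψ]) _ hderiv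
  refine ⟨φ, hφ0, hφ.mono fun p hp => ⟨hp.1, ?_, ?_⟩⟩
  · have := congrArg Prod.fst hp.2
    simp only [Ψ, Prod.fst_zero] at this
    rwa [sub_sub, sub_eq_zero] at this
  · have := congrArg Prod.snd hp.2
    simp only [Ψ, Prod.snd_zero] at this
    rwa [sub_add, sub_eq_zero] at this

/-- For every `(σ, v)` near `(τ₀, 0)` there is an orbit of `(τ, v) ↦ (τ + v α, v β)` that stays near
`(τ₀, 0)`, converges to `(σ, 0)` and starts at a point `(h (σ, v), v)`, where `h` is smooth.

The orbit is sought in the form `(σ + qⁿ eₙ, qⁿ wₙ)` with `r < q < 1` and convergent sequences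
`e`, `w`. The equation for `w` is solved forwards from `w₀ = v` and the one for `e` backwards,
which makes both contracting. -/
theorem exists_stable_orbit_family {α β : ℝ × ℝ → ℝ} (hα : ContDiff ℝ ∞ α) (hβ : ContDiff ℝ ∞ β)
    {τ₀ r : ℝ} (hr0 : 0 < r) (hr1 : r < 1) (hβ0 : β (τ₀, 0) = r) :
    ∃ h : ℝ × ℝ → ℝ, h (τ₀, 0) = τ₀ ∧ (∀ᶠ p in 𝓝 ((τ₀, 0) : ℝ × ℝ), ContDiffAt ℝ ∞ h p) ∧
      ∀ ε > 0, ∀ᶠ p in 𝓝 ((τ₀, 0) : ℝ × ℝ), ∃ z : ℕ → ℝ × ℝ, z 0 = (h p, p.2) ∧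
        (∀ n, z (n + 1) = ((z n).1 + (z n).2 * α (z n), (z n).2 * β (z n))) ∧
        (∀ n, dist (z n) (τ₀, 0) < ε) ∧ Tendsto z atTop (𝓝 (p.1, 0)) := by
  obtain ⟨q, hrq, hq1⟩ := exists_between hr1
  have hq0 : 0 < q := hr0.trans hrq
  let Q : C(OnePoint ℕ, ℝ) := ofSeq (fun n => q ^ n) 0
    (tendsto_pow_atTop_nhds_zero_of_lt_one hq0.le hq1)
  let z : (ℝ × ℝ) × (C(OnePoint ℕ, ℝ) × C(OnePoint ℕ, ℝ)) → C(OnePoint ℕ, ℝ × ℝ) := fun x =>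
    constCLM _ _ (x.1.1, 0) +
      (ContinuousLinearMap.inl ℝ ℝ ℝ).compLeftContinuous ℝ _ (Q * x.2.2) +
      (ContinuousLinearMap.inr ℝ ℝ ℝ).compLeftContinuous ℝ _ (Q * x.2.1)
  have hz : ContDiff ℝ ∞ z := by
    have h1 : ContDiff ℝ ∞ fun x : (ℝ × ℝ) × (C(OnePoint ℕ, ℝ) × C(OnePoint ℕ, ℝ)) =>
        ((x.1.1, 0) : ℝ × ℝ) := contDiff_fst.fst.prodMk contDiff_const
    exact ((contDiff_constCLM.comp h1).add
      ((contDiff_compLeft _).comp (contDiff_const.mul contDiff_snd.snd))).add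
      ((contDiff_compLeft _).comp (contDiff_const.mul contDiff_snd.fst))
  have hzk : ∀ x k, z x k = (x.1.1 + Q k * x.2.2 k, Q k * x.2.1 k) := fun x k => by
    ext <;> simp [z]
  have hz0 : z ((τ₀, 0), 0) = ContinuousMap.const _ (τ₀, 0) := by
    ext k <;> simp [hzk]
  have hA : ContDiff ℝ ∞ fun x => superposition α hα.continuous (z x) :=
    (contDiff_superposition hα).comp hz
  have hB : ContDiff ℝ ∞ fun x => superposition β hβ.continuous (z x) :=
    (contDiff_superposition hβ).comp hz
  obtain ⟨φ, hφ0, hφ⟩ := exists_contDiffAt_fixedPair norm_leftShift_le norm_rightShift_le seqSingle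
    hA hB hr0 hrq hq1 (τ₀ := τ₀) (a := α (τ₀, 0)) (by ext k; simp [hz0])
    (by ext k; simp [hz0, hβ0])
  refine ⟨fun p => p.1 + (φ p).2 ((0 : ℕ) : OnePoint ℕ), by simp [hφ0], ?_, fun ε hε => ?_⟩
  · filter_upwards [hφ] with p hp
    exact contDiff_fst.contDiffAt.add ((contDiff_eval _).contDiffAt.comp p hp.1.snd)
  have hcont : ContinuousAt (fun p => z (p, φ p)) (τ₀, 0) :=
    hz.continuous.continuousAt.comp (continuousAt_id.prodMk hφ.self_of_nhds.1.continuousAt)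
  have hnear : ∀ᶠ p in 𝓝 ((τ₀, 0) : ℝ × ℝ),
      dist (z (p, φ p)) (z ((τ₀, 0), φ (τ₀, 0))) < ε := hcont.eventually (Metric.ball_mem_nhds _ hε)
  rw [hφ0, hz0] at hnear
  filter_upwards [hφ, hnear] with p hφp hp
  obtain ⟨-, hw, he⟩ := hφp
  have hQ : ∀ n : ℕ, Q (n : OnePoint ℕ) = q ^ n := fun n => rfl
  refine ⟨fun n => z (p, φ p) n, ?_, fun n => ?_, fun n =>
    (ContinuousMap.dist_apply_le_dist (n : OnePoint ℕ)).trans_lt hp, ?_⟩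
  · have h := congrArg (fun u => u ((0 : ℕ) : OnePoint ℕ)) hw
    simp only [ContinuousMap.add_apply, ContinuousMap.smul_apply, rightShift_zero, smul_zero,
      add_zero] at h
    beta_reduce
    rw [hzk, hQ, h]
    simp [seqSingle]
  · have h1 := congrArg (fun u => u ((n + 1 : ℕ) : OnePoint ℕ)) hw
    have h2 := congrArg (fun u => u (n : OnePoint ℕ)) he
    simp only [ContinuousMap.add_apply, ContinuousMap.smul_apply, ContinuousMap.sub_apply,
      ContinuousMap.mul_apply, rightShift_succ, leftShift_coe, superposition_apply,
      smul_eq_mul] at h1 h2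
    have h3 : seqSingle ((n + 1 : ℕ) : OnePoint ℕ) = 0 := by simp [seqSingle]
    rw [h3, mul_zero, zero_add] at h1
    have hzn := hzk (p, φ p) (n : OnePoint ℕ)
    rw [hQ] at hzn
    beta_reduce
    rw [hzk (p, φ p) ((n + 1 : ℕ) : OnePoint ℕ), hQ]
    ext
    · have : (z (p, φ p) n).1 = p.1 + q ^ n * (φ p).2 n := by rw [hzn]
      have h5 : (z (p, φ p) n).2 = q ^ n * (φ p).1 n := by rw [hzn]
      simp only [this]
      rw [h5]
      linear_combination -(q ^ n) * h2
    · have h5 : (z (p, φ p) n).2 = q ^ n * (φ p).1 n := by rw [hzn]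
      simp only [h1]
      rw [h5]
      field_simp
      ring
  · have h := tendsto_coe_onePoint (z (p, φ p))
    rw [hzk] at h
    simpa [Q] using h

end Sequences

/-! ### The local stable foliation -/

section LocalFoliation

/-- The partial map with graph `R` can be iterated forever at `w`, and the iterates converge to
`(σ, 0)`. -/
def IsAttracted (R : ℝ × ℝ → ℝ × ℝ → Prop) (w : ℝ × ℝ) (σ : ℝ) : Prop :=
  ∃ orbit : ℕ → ℝ × ℝ, orbit 0 = w ∧ (∀ n, R (orbit n) (orbit (n + 1))) ∧
    Tendsto orbit atTop (𝓝 (σ, 0))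

/-- At `p = (σ, v)` the function `H` is smooth with nonzero derivative in `σ`, the point
`(H p, v)` is attracted to `(σ, 0)`, and `R` takes it to a point of the same form with the same
`σ` and a second coordinate that is not larger. -/
structure IsFoliationAt (R : ℝ × ℝ → ℝ × ℝ → Prop) (H : ℝ × ℝ → ℝ) (p : ℝ × ℝ) : Prop where
  contDiffAt : ContDiffAt ℝ ∞ H p
  fderiv_ne_zero : fderiv ℝ H p (1, 0) ≠ 0
  isAttracted : IsAttracted R (H p, p.2) p.1
  step : ∃ v, |v| ≤ |p.2| ∧ R (H p, p.2) (H (p.1, v), v)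

variable {R : ℝ × ℝ → ℝ × ℝ → Prop}

lemma orbit_eq_of_rightUnique (hR : Relator.RightUnique R) {o o' : ℕ → ℝ × ℝ} (h0 : o 0 = o' 0)
    (h : ∀ n, R (o n) (o (n + 1))) (h' : ∀ n, R (o' n) (o' (n + 1))) : o = o' := by
  funext n
  induction n with
  | zero => exact h0
  | succ n ih => exact hR (h n) (ih ▸ h' n)

lemma IsAttracted.unique (hR : Relator.RightUnique R) {w : ℝ × ℝ} {σ σ' : ℝ}
    (h : IsAttracted R w σ) (h' : IsAttracted R w σ') : σ = σ' := by
  obtain ⟨o, ho0, ho, hot⟩ := h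
  obtain ⟨o', ho0', ho', hot'⟩ := h'
  obtain rfl := orbit_eq_of_rightUnique hR (ho0.trans ho0'.symm) ho ho'
  exact congrArg Prod.fst (tendsto_nhds_unique hot hot')

lemma IsAttracted.of_step (hR : Relator.RightUnique R) {w w' : ℝ × ℝ} {σ : ℝ}
    (h : IsAttracted R w σ) (hw : R w w') : IsAttracted R w' σ := by
  obtain ⟨o, rfl, ho, hot⟩ := h
  exact ⟨fun n => o (n + 1), hR (ho 0) hw, fun n => ho (n + 1), (tendsto_add_atTop_iff_nat 1).2 hot⟩

/-- The map `p ↦ (h p, p.2)` is a local homeomorphism where `∂h/∂σ ≠ 0`. -/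
lemma map_prodMk_snd_nhds {h : ℝ × ℝ → ℝ} {p : ℝ × ℝ} (hs : ContDiffAt ℝ ∞ h p)
    (hd : fderiv ℝ h p (1, 0) ≠ 0) :
    map (fun p => (h p, p.2)) (𝓝 p) = 𝓝 (h p, p.2) := by
  have hst : HasStrictFDerivAt (fun p : ℝ × ℝ => (h p, p.2))
      ((fderiv ℝ h p).prod (ContinuousLinearMap.snd ℝ ℝ ℝ)) p :=
    (hs.hasStrictFDerivAt (by simp)).prodMk hasStrictFDerivAt_snd
  refine hst.map_nhds_eq_of_surj (LinearMap.range_eq_top.2 fun ⟨x, y⟩ => ?_)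
  refine ⟨(((x - fderiv ℝ h p (0, y)) / fderiv ℝ h p (1, 0)), y), ?_⟩
  have hsplit : ∀ s : ℝ, ((s, y) : ℝ × ℝ) = s • (1, 0) + (0, y) := fun s => by simp
  ext
  · change fderiv ℝ h p (_, y) = x
    rw [hsplit, map_add, map_smul, smul_eq_mul, div_mul_cancel₀ _ hd]
    ring
  · rfl

/-- A partial map that is `(τ, v) ↦ (τ + v α, v β)` near `(τ₀, 0)` has a foliation there by the
graphs `v ↦ (h (σ, v), v)` of points attracted to `(σ, 0)`. All attracted points near `(τ₀, 0)`
lie on these graphs, since `(σ, v) ↦ (h (σ, v), v)` is a local diffeomorphism; this gives the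
invariance of the graphs, and differentiating the invariance gives the slope
`∂h/∂v = α / (r - 1)`. -/
theorem exists_local_stable_foliation (hR : Relator.RightUnique R) {α β : ℝ × ℝ → ℝ}
    (hα : ContDiff ℝ ∞ α) (hβ : ContDiff ℝ ∞ β) {τ₀ r : ℝ} (hr0 : 0 < r) (hr1 : r < 1)
    (hβ0 : β (τ₀, 0) = r)
    (hstep : ∀ᶠ w in 𝓝 ((τ₀, 0) : ℝ × ℝ), R w (w.1 + w.2 * α w, w.2 * β w)) :
    ∃ h : ℝ × ℝ → ℝ, h (τ₀, 0) = τ₀ ∧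
      (∀ᶠ p in 𝓝 ((τ₀, 0) : ℝ × ℝ), IsFoliationAt R h p) ∧
      (∀ᶠ w in 𝓝 ((τ₀, 0) : ℝ × ℝ), ∀ σ, IsAttracted R w σ → w.1 = h (σ, w.2)) ∧
      HasDerivAt (fun v => h (τ₀, v)) (α (τ₀, 0) / (r - 1)) 0 := by
  obtain ⟨h, h0, hs, horb⟩ := exists_stable_orbit_family hα hβ hr0 hr1 hβ0
  have hs0 := hs.self_of_nhds
  obtain ⟨ε, hε, Hε⟩ := Metric.eventually_nhds_iff_ball.1 hstep
  have hatt : ∀ᶠ p in 𝓝 ((τ₀, 0) : ℝ × ℝ), IsAttracted R (h p, p.2) p.1 := by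
    filter_upwards [horb ε hε] with p ⟨z, hz0, hz, hzε, hzt⟩
    exact ⟨z, hz0, fun n => hz n ▸ Hε _ (hzε n), hzt⟩
  have hΘ : Tendsto (fun p => (h p, p.2)) (𝓝 ((τ₀, 0) : ℝ × ℝ)) (𝓝 (τ₀, 0)) := by
    have := hs0.continuousAt.prodMk continuousAt_snd
    rw [ContinuousAt, h0] at this
    exact this
  -- the points with `v = 0` are fixed
  have hfix : ∀ᶠ p in 𝓝 ((τ₀, 0) : ℝ × ℝ), p.2 = 0 → h p = p.1 := by
    filter_upwards [hatt, hΘ.eventually hstep] with p hp1 hp2 hp0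
    rw [hp0] at hp1 hp2
    simp only [zero_mul, add_zero] at hp2
    exact IsAttracted.unique hR ⟨fun _ => (h p, 0), rfl, fun _ => hp2, tendsto_const_nhds⟩ hp1
  have hd1 : fderiv ℝ h (τ₀, 0) (1, 0) = 1 := by
    have h1 : HasDerivAt (fun σ : ℝ => h (σ, 0)) (fderiv ℝ h (τ₀, 0) (1, 0)) τ₀ :=
      HasFDerivAt.comp_hasDerivAt (f := fun σ : ℝ => (σ, (0 : ℝ))) τ₀
        ((hs0.differentiableAt (by simp)).hasFDerivAt)
        ((hasDerivAt_id τ₀).prodMk (hasDerivAt_const _ _))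
    have ht : Tendsto (fun σ : ℝ => (σ, (0 : ℝ))) (𝓝 τ₀) (𝓝 (τ₀, 0)) :=
      tendsto_id.prodMk_nhds tendsto_const_nhds
    refine h1.unique ((hasDerivAt_id τ₀).congr_of_eventuallyEq ?_)
    filter_upwards [ht.eventually hfix] with σ hσ
    exact hσ rfl
  have hd : ∀ᶠ p in 𝓝 ((τ₀, 0) : ℝ × ℝ), fderiv ℝ h p (1, 0) ≠ 0 := by
    have hc : ContinuousAt (fun p => fderiv ℝ h p (1, 0)) (τ₀, 0) :=
      (hs0.continuousAt_fderiv (by simp)).clm_apply continuousAt_const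
    exact hc.eventually_ne (by rw [hd1]; exact one_ne_zero)
  -- every point near `(τ₀, 0)` lies on one of the curves
  have huniq : ∀ᶠ w in 𝓝 ((τ₀, 0) : ℝ × ℝ), ∀ σ, IsAttracted R w σ → w.1 = h (σ, w.2) := by
    have hmap := map_prodMk_snd_nhds hs0 hd.self_of_nhds
    have hw : ∀ᶠ w in map (fun p => (h p, p.2)) (𝓝 ((τ₀, 0) : ℝ × ℝ)),
        ∃ p : ℝ × ℝ, (h p, p.2) = w ∧ IsAttracted R w p.1 :=
      eventually_map.2 (hatt.mono fun p hp => ⟨p, rfl, hp⟩)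
    rw [hmap, h0] at hw
    filter_upwards [hw]
    rintro _ ⟨⟨σ', v⟩, rfl, hp⟩ σ hσ
    rw [← hp.unique hR hσ]
  have hinv : ∀ᶠ p in 𝓝 ((τ₀, 0) : ℝ × ℝ),
      h p + p.2 * α (h p, p.2) = h (p.1, p.2 * β (h p, p.2)) := by
    have ht : Tendsto (fun w : ℝ × ℝ => (w.1 + w.2 * α w, w.2 * β w)) (𝓝 (τ₀, 0))
        (𝓝 (τ₀, 0)) := by
      have : Continuous fun w : ℝ × ℝ => (w.1 + w.2 * α w, w.2 * β w) :=
        (continuous_fst.add (continuous_snd.mul hα.continuous)).prodMk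
          (continuous_snd.mul hβ.continuous)
      simpa using this.tendsto (τ₀, 0)
    filter_upwards [hatt, hΘ.eventually hstep, (ht.comp hΘ).eventually huniq] with p h1 h2 h3
    exact h3 _ (h1.of_step hR h2)
  refine ⟨h, h0, ?_, huniq, ?_⟩
  · have hβ1 : ∀ᶠ w in 𝓝 ((τ₀, 0) : ℝ × ℝ), |β w| < 1 :=
      hβ.continuous.abs.continuousAt.eventually_lt continuousAt_const
        (by rwa [hβ0, abs_of_pos hr0])
    filter_upwards [hs, hd, hatt, hinv, hΘ.eventually hstep, hΘ.eventually hβ1]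
      with p h1 h2 h3 h4 h5 h6
    refine ⟨h1, h2, h3, p.2 * β (h p, p.2), ?_, ?_⟩
    · rw [abs_mul]
      exact mul_le_of_le_one_right (abs_nonneg _) h6.le
    · rw [← h4]
      exact h5
  · -- differentiate the invariance relation along `σ = τ₀` at `v = 0`
    have hline : HasDerivAt (fun v : ℝ => (τ₀, v)) (0, 1) 0 :=
      (hasDerivAt_const _ _).prodMk (hasDerivAt_id 0)
    have hk : HasDerivAt (fun v : ℝ => h (τ₀, v)) (fderiv ℝ h (τ₀, 0) (0, 1)) 0 :=
      HasFDerivAt.comp_hasDerivAt (f := fun v : ℝ => (τ₀, v)) 0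
        ((hs0.differentiableAt (by simp)).hasFDerivAt) hline
    set m := fderiv ℝ h (τ₀, 0) (0, 1)
    have hcomp : ∀ {γ : ℝ × ℝ → ℝ}, ContDiff ℝ ∞ γ →
        HasDerivAt (fun v : ℝ => v * γ (h (τ₀, v), v)) (γ (τ₀, 0)) 0 := fun {γ} hγ => by
      have h1 : DifferentiableAt ℝ (fun v : ℝ => γ (h (τ₀, v), v)) 0 :=
        DifferentiableAt.comp (g := γ) (f := fun v : ℝ => (h (τ₀, v), v)) 0
          (hγ.differentiable (by simp) _) (hk.differentiableAt.prodMk differentiableAt_id)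
      have h2 := (hasDerivAt_id' (0 : ℝ)).fun_mul h1.hasDerivAt
      simpa [h0] using h2
    have hb := hcomp hβ
    have hl : HasDerivAt (fun v : ℝ => h (τ₀, v * β (h (τ₀, v), v))) (m * r) 0 := by
      rw [hβ0] at hb
      exact HasDerivAt.comp (h₂ := fun v : ℝ => h (τ₀, v))
        (h := fun v : ℝ => v * β (h (τ₀, v), v)) 0 (by simpa using hk) hb
    have hr := hk.add (hcomp hα)
    have ht : Tendsto (fun v : ℝ => (τ₀, v)) (𝓝 0) (𝓝 (τ₀, 0)) :=
      tendsto_const_nhds.prodMk_nhds tendsto_id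
    have heq := hl.unique (hr.congr_of_eventuallyEq ((ht.eventually hinv).mono fun v hv => hv.symm))
    have hm : m = α (τ₀, 0) / (r - 1) := by
      rw [eq_div_iff (by linarith)]
      linarith
    rwa [← hm]

end LocalFoliation

/-! ### A diffeomorphism of the line onto an interval -/

section Squash

/-- A diffeomorphism of the line onto the interval `(-1, 1)`. -/
noncomputable def squash (s : ℝ) : ℝ := 2 / Real.pi * Real.arctan s

lemma strictMono_squash : StrictMono squash :=
  Real.arctan_strictMono.const_mul (by positivity)

lemma squash_zero : squash 0 = 0 := by simp [squash]

lemma contDiff_squash : ContDiff ℝ ∞ squash := contDiff_const.mul Real.contDiff_arctan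

lemma hasDerivAt_squash (s : ℝ) : HasDerivAt squash (2 / Real.pi * (1 / (1 + s ^ 2))) s :=
  (Real.hasDerivAt_arctan s).const_mul _

lemma range_squash : range squash = Ioo (-1) 1 := by
  have hpi := Real.pi_pos
  ext x
  constructor
  · rintro ⟨s, rfl⟩
    have h1 := Real.arctan_lt_pi_div_two s
    have h2 := Real.neg_pi_div_two_lt_arctan s
    simp only [squash, mem_Ioo, div_mul_eq_mul_div, lt_div_iff₀ hpi, div_lt_iff₀ hpi]
    constructor <;> linarith
  · rintro ⟨h1, h2⟩
    refine ⟨Real.tan (x * (Real.pi / 2)), ?_⟩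
    rw [squash, Real.arctan_tan (by nlinarith) (by nlinarith)]
    field_simp

lemma abs_squash_lt (s : ℝ) : |squash s| < 1 :=
  abs_lt.2 (range_squash.subset (mem_range_self s))

lemma exists_squash_eq {x : ℝ} (hx : |x| < 1) : ∃ s, squash s = x := by
  rw [← mem_range, range_squash]
  exact abs_lt.1 hx

lemma isOpenEmbedding_squash : IsOpenEmbedding squash where
  toIsEmbedding := strictMono_squash.isEmbedding_of_ordConnected (by
    rw [range_squash]
    exact ordConnected_Ioo)
  isOpen_range := by
    rw [range_squash]
    exact isOpen_Ioo

end Squash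

/-! ### Gluing the local foliations -/

section Gluing

/-- Radii that can be chosen locally can be chosen to depend continuously on the point, by a
partition of unity. -/
lemma exists_continuous_pos_of_locally {X : Type*} [TopologicalSpace X] [NormalSpace X]
    [ParacompactSpace X] {P : X → ℝ → Prop} (hanti : ∀ x ε ε', ε' ≤ ε → P x ε → P x ε')
    (hloc : ∀ x, ∃ ε > 0, ∀ᶠ y in 𝓝 x, P y ε) : ∃ η : C(X, ℝ), ∀ x, 0 < η x ∧ P x (η x) := by
  refine exists_continuous_forall_mem_convex_of_local_const (t := fun x => {ε | 0 < ε ∧ P x ε})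
    (fun x => ?_) fun x => ?_
  · refine OrdConnected.convex ⟨fun a ha b hb ε hε => ⟨?_, ?_⟩⟩
    · exact ha.1.trans_le hε.1
    · exact hanti _ _ _ hε.2 hb.2
  · obtain ⟨ε, hε, h⟩ := hloc x
    exact ⟨ε, h.mono fun y hy => ⟨hε, hy⟩⟩

lemma mem_ball_prod_real {x y a b ε : ℝ} :
    ((x, y) : ℝ × ℝ) ∈ Metric.ball ((a, b) : ℝ × ℝ) ε ↔ |x - a| < ε ∧ |y - b| < ε := by
  rw [Metric.mem_ball, Prod.dist_eq, max_lt_iff, Real.dist_eq, Real.dist_eq]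

variable {R : ℝ × ℝ → ℝ × ℝ → Prop}

/-- The local foliations around the points of `J` fit together to one function `H`, which describes
the leaf of `τ ∈ J` for `|v| < η τ`. They agree where they overlap, because attracted points close
enough to `(τ, 0)` are determined by `τ` and their second coordinate. -/
theorem exists_global_foliation {J : Set ℝ} (hJ : IsOpen J)
    {m : ℝ → ℝ}
    (hloc : ∀ τ₀ ∈ J, ∃ h : ℝ × ℝ → ℝ, h (τ₀, 0) = τ₀ ∧
      (∀ᶠ p in 𝓝 ((τ₀, 0) : ℝ × ℝ), IsFoliationAt R h p) ∧
      (∀ᶠ w in 𝓝 ((τ₀, 0) : ℝ × ℝ), ∀ σ, IsAttracted R w σ → w.1 = h (σ, w.2)) ∧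
      HasDerivAt (fun v => h (τ₀, v)) (m τ₀) 0) :
    ∃ (H : ℝ × ℝ → ℝ) (η : C(J, ℝ)), ∀ τ : J, 0 < η τ ∧
      (∀ v, |v| < η τ → IsFoliationAt R H (τ, v)) ∧ H (τ, 0) = τ ∧
      HasDerivAt (fun v => H (τ, v)) (m τ) 0 := by
  -- a radius below which the attracted points are determined by their second coordinate
  obtain ⟨e, he⟩ := exists_continuous_pos_of_locally (X := J) (P := fun σ ε => ∀ τ τ' v : ℝ,
      |τ - σ| < ε → |τ' - σ| < ε → |v| < ε → IsAttracted R (τ, v) σ → IsAttracted R (τ', v) σ →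
      τ = τ')
    (fun σ ε ε' hε h τ τ' v h1 h2 h3 => h τ τ' v (h1.trans_le hε) (h2.trans_le hε)
      (h3.trans_le hε))
    (fun τ₀ => by
      obtain ⟨h, -, -, hu, -⟩ := hloc τ₀ τ₀.2
      obtain ⟨ε, hε, H⟩ := Metric.eventually_nhds_iff_ball.1 hu
      refine ⟨ε / 2, by positivity, ?_⟩
      have hnear : ∀ᶠ σ : J in 𝓝 τ₀, |(σ : ℝ) - τ₀| < ε / 2 :=
        continuous_subtype_val.continuousAt.eventually (Metric.ball_mem_nhds _ (by positivity))
      filter_upwards [hnear] with σ hσ τ τ' v h1 h2 h3 ha ha'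
      have hb : ∀ t : ℝ, |t - σ| < ε / 2 → ((t, v) : ℝ × ℝ) ∈ Metric.ball ((τ₀, 0) : ℝ × ℝ) ε :=
        fun t ht => mem_ball_prod_real.2
          ⟨(abs_sub_le t σ τ₀).trans_lt (by linarith), by rw [sub_zero]; linarith⟩
      exact (H _ (hb τ h1) σ ha).trans (H _ (hb τ' h2) σ ha').symm)
  have hex : ∀ p : ℝ × ℝ, ∃ x, ∀ (hp : p.1 ∈ J) (τ : ℝ), |τ - p.1| < e ⟨p.1, hp⟩ →
      |p.2| < e ⟨p.1, hp⟩ → IsAttracted R (τ, p.2) p.1 → x = τ := fun p => by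
    by_cases h : ∃ (hp : p.1 ∈ J) (τ : ℝ), |τ - p.1| < e ⟨p.1, hp⟩ ∧
        |p.2| < e ⟨p.1, hp⟩ ∧ IsAttracted R (τ, p.2) p.1
    · obtain ⟨hp, τ, h1, h2, h3⟩ := h
      exact ⟨τ, fun hp τ' h1' _ h3' => (he ⟨p.1, hp⟩).2 τ τ' p.2 h1 h1' h2 h3 h3'⟩
    · exact ⟨0, fun hp τ h1 h2 h3 => (h ⟨hp, τ, h1, h2, h3⟩).elim⟩
  choose H hH using hex
  -- near `(τ₀, 0)` the function `H` is the local one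
  have hagree : ∀ τ₀ : J, ∃ h : ℝ × ℝ → ℝ, h (τ₀, 0) = τ₀ ∧
      (∀ᶠ p in 𝓝 ((τ₀, 0) : ℝ × ℝ), IsFoliationAt R h p ∧ H p = h p) ∧
      HasDerivAt (fun v => h (τ₀, v)) (m τ₀) 0 := fun τ₀ => by
    obtain ⟨h, h0, hf, -, hd⟩ := hloc τ₀ τ₀.2
    refine ⟨h, h0, ?_, hd⟩
    have hpos := (he τ₀).1
    have he1 : ∀ᶠ σ in 𝓝 (τ₀ : ℝ), ∃ hσ : σ ∈ J, e τ₀ / 2 < e ⟨σ, hσ⟩ := by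
      rw [← hJ.isOpenEmbedding_subtypeVal.map_nhds_eq τ₀, eventually_map]
      filter_upwards [continuousAt_const.eventually_lt e.continuous.continuousAt
        (half_lt_self hpos)] with σ hσ
      exact ⟨σ.2, hσ⟩
    have hc : ContinuousAt (fun p => |h p - p.1|) ((τ₀, 0) : ℝ × ℝ) :=
      (hf.self_of_nhds.contDiffAt.continuousAt.sub continuousAt_fst).abs
    have he2 : ∀ᶠ p in 𝓝 ((τ₀, 0) : ℝ × ℝ), |h p - p.1| < e τ₀ / 2 :=
      hc.eventually_lt continuousAt_const (by simpa [h0] using hpos)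
    have he3 : ∀ᶠ p in 𝓝 ((τ₀, 0) : ℝ × ℝ), |p.2| < e τ₀ / 2 :=
      continuousAt_snd.abs.eventually_lt continuousAt_const (by simpa using hpos)
    filter_upwards [hf, continuousAt_fst.eventually he1, he2, he3] with p h1 ⟨hp, h2⟩ h3 h4
    exact ⟨h1, hH p hp _ (h3.trans h2) (h4.trans h2) h1.isAttracted⟩
  obtain ⟨η, hη⟩ := exists_continuous_pos_of_locally (X := J)
    (P := fun σ ε => ∀ v, |v| < ε → IsFoliationAt R H (σ, v))
    (fun σ ε ε' hε h v hv => h v (hv.trans_le hε))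
    (fun τ₀ => by
      obtain ⟨h, h0, hf, -⟩ := hagree τ₀
      obtain ⟨ε, hε, hb⟩ := Metric.eventually_nhds_iff_ball.1 hf
      refine ⟨ε, hε, ?_⟩
      have hnear : ∀ᶠ σ : J in 𝓝 τ₀, |(σ : ℝ) - τ₀| < ε :=
        continuous_subtype_val.continuousAt.eventually (Metric.ball_mem_nhds _ hε)
      filter_upwards [hnear] with σ hσ v hv
      have hmem : ∀ v' : ℝ, |v'| ≤ |v| →
          ((σ, v') : ℝ × ℝ) ∈ Metric.ball ((τ₀, 0) : ℝ × ℝ) ε := fun v' hv' =>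
        mem_ball_prod_real.2 ⟨hσ, by rw [sub_zero]; exact hv'.trans_lt hv⟩
      have hp := hb _ (hmem v le_rfl)
      have heq : H =ᶠ[𝓝 ((σ, v) : ℝ × ℝ)] h := by
        filter_upwards [Metric.isOpen_ball.mem_nhds (hmem v le_rfl)] with q hq
        exact (hb q hq).2
      refine ⟨hp.1.contDiffAt.congr_of_eventuallyEq heq, ?_, ?_, ?_⟩
      · rw [heq.fderiv_eq]
        exact hp.1.fderiv_ne_zero
      · rw [hp.2]
        exact hp.1.isAttracted
      · obtain ⟨v', hv', hs⟩ := hp.1.step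
        refine ⟨v', hv', ?_⟩
        rw [hp.2, (hb _ (hmem v' hv')).2]
        exact hs)
  refine ⟨H, η, fun τ => ⟨(hη τ).1, (hη τ).2, ?_⟩⟩
  obtain ⟨h, h0, hf, hd⟩ := hagree τ
  have ht : Tendsto (fun v : ℝ => ((τ, v) : ℝ × ℝ)) (𝓝 0) (𝓝 ((τ : ℝ), (0 : ℝ))) :=
    tendsto_const_nhds.prodMk_nhds tendsto_id
  exact ⟨hf.self_of_nhds.2.trans h0,
    hd.congr_of_eventuallyEq ((ht.eventually hf).mono fun v hv => hv.2)⟩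

end Gluing

/-! ### The leaves as curves and the foliation chart -/

section Assembly

variable {R : ℝ × ℝ → ℝ × ℝ → Prop} {J : Set ℝ} {H : ℝ × ℝ → ℝ} {η : C(J, ℝ)}

/-- The chart `(τ, s) ↦ (H (τ, v), v)`, where `v = η τ * squash s`, of the foliation with leaves
`{(H (τ, v), v) : |v| < η τ}`. -/
noncomputable def foliationChart (H : ℝ × ℝ → ℝ) (η : C(J, ℝ)) (x : J × ℝ) : ℝ × ℝ :=
  (H (x.1, η x.1 * squash x.2), η x.1 * squash x.2)

lemma abs_mul_squash_lt {b : ℝ} (hb : 0 < b) (s : ℝ) : |b * squash s| < b := by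
  rw [abs_mul, abs_of_pos hb]
  exact mul_lt_of_lt_one_right hb (abs_squash_lt s)

lemma exists_mul_squash_eq {b v : ℝ} (hb : 0 < b) (hv : |v| < b) : ∃ s, b * squash s = v := by
  obtain ⟨s, hs⟩ := exists_squash_eq (x := v / b) (by
    rwa [abs_div, abs_of_pos hb, div_lt_one hb])
  exact ⟨s, by rw [hs]; field_simp⟩

/-- The map `(τ, s) ↦ (τ, η τ * squash s)` identifies `J × ℝ` with `{(τ, v) : τ ∈ J, |v| < η τ}`. -/
lemma isOpenEmbedding_graph_squash (hJ : IsOpen J) (hη : ∀ τ, 0 < η τ) :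
    IsOpenEmbedding (fun x : J × ℝ => ((x.1, η x.1 * squash x.2) : ℝ × ℝ)) := by
  let shear : (J × ℝ) ≃ₜ (J × ℝ) :=
    { toFun := fun x => (x.1, η x.1 * x.2)
      invFun := fun x => (x.1, (η x.1)⁻¹ * x.2)
      left_inv := fun x => by simp [(hη x.1).ne']
      right_inv := fun x => by simp [(hη x.1).ne']
      continuous_toFun := by fun_prop
      continuous_invFun := continuous_fst.prodMk
        (((η.continuous.comp continuous_fst).inv₀ fun x => (hη x.1).ne').mul continuous_snd) }
  exact (hJ.isOpenEmbedding_subtypeVal.prodMap IsOpenEmbedding.id).comp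
    (shear.isOpenEmbedding.comp (IsOpenEmbedding.id.prodMap isOpenEmbedding_squash))

lemma isAttracted_foliationChart (hη : ∀ τ, 0 < η τ)
    (hH : ∀ (τ : J) (v : ℝ), |v| < η τ → IsFoliationAt R H (τ, v))
    (x : J × ℝ) : IsAttracted R (foliationChart H η x) x.1 :=
  (hH x.1 _ (abs_mul_squash_lt (hη x.1) x.2)).isAttracted

lemma isOpenEmbedding_foliationChart (hR : Relator.RightUnique R) (hη : ∀ τ, 0 < η τ)
    (hH : ∀ (τ : J) (v : ℝ), |v| < η τ → IsFoliationAt R H (τ, v))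
    (hJ : IsOpen J) : IsOpenEmbedding (foliationChart H η) := by
  have hg := isOpenEmbedding_graph_squash hJ hη
  have hf := fun x : J × ℝ => hH x.1 _ (abs_mul_squash_lt (hη x.1) x.2)
  refine .of_continuous_injective_isOpenMap ?_ ?_ ?_
  · refine continuous_iff_continuousAt.2 fun x => ?_
    have h := (hf x).contDiffAt.continuousAt.prodMk continuousAt_snd
    exact ContinuousAt.comp (f := fun x : J × ℝ => ((x.1, η x.1 * squash x.2) : ℝ × ℝ)) h
      hg.continuous.continuousAt
  · intro x y hxy
    have h1 : (x.1 : ℝ) = y.1 := (isAttracted_foliationChart hη hH x).unique hR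
      (hxy ▸ isAttracted_foliationChart hη hH y)
    have h2 : η x.1 * squash x.2 = η y.1 * squash y.2 := congrArg (fun w : ℝ × ℝ => w.2) hxy
    exact hg.injective (Prod.ext h1 h2)
  · refine isOpenMap_iff_nhds_le.2 fun x => ?_
    have h := map_prodMk_snd_nhds (hf x).contDiffAt (hf x).fderiv_ne_zero
    have h2 : 𝓝 ((x.1 : ℝ), η x.1 * squash x.2) = map _ (𝓝 x) := (hg.map_nhds_eq x).symm
    rw [h2, map_map] at h
    exact h.ge

lemma range_foliationChart_eq (hR : Relator.RightUnique R) (hη : ∀ τ, 0 < η τ)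
    (hH : ∀ (τ : J) (v : ℝ), |v| < η τ → IsFoliationAt R H (τ, v))
    (τ : J) :
    range (fun s => foliationChart H η (τ, s)) =
      {w ∈ range (foliationChart H η) | IsAttracted R w τ} := by
  ext w
  constructor
  · rintro ⟨s, rfl⟩
    exact ⟨mem_range_self _, isAttracted_foliationChart hη hH (τ, s)⟩
  · rintro ⟨⟨⟨σ, s⟩, rfl⟩, hw⟩
    have h : σ = τ := Subtype.ext ((isAttracted_foliationChart hη hH (σ, s)).unique hR hw)
    exact ⟨s, by rw [h]⟩

lemma exists_step_foliationChart (hη : ∀ τ, 0 < η τ)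
    (hH : ∀ (τ : J) (v : ℝ), |v| < η τ → IsFoliationAt R H (τ, v))
    (τ : J) (s : ℝ) :
    ∃ s', R (foliationChart H η (τ, s)) (foliationChart H η (τ, s')) := by
  have hs := abs_mul_squash_lt (hη τ) s
  obtain ⟨v, hv, hstep⟩ := (hH τ _ hs).step
  obtain ⟨s', rfl⟩ := exists_mul_squash_eq (hη τ) (hv.trans_lt hs)
  exact ⟨s', hstep⟩

/-- A leaf is a smooth curve through `(τ, 0)`. The parameter is multiplied by a constant `k`,
chosen so that the second coordinate of the velocity at `(τ, 0)` is `b`. -/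
lemma isSmoothCurveThrough_range_foliationChart {m b : ℝ} (hη : ∀ τ, 0 < η τ)
    (hH : ∀ (τ : J) (v : ℝ), |v| < η τ → IsFoliationAt R H (τ, v))
    (τ : J) (hH0 : H (τ, 0) = τ)
    (hm : HasDerivAt (fun v => H (τ, v)) m 0) (hb : b ≠ 0) :
    IsSmoothCurveThrough (range fun s => foliationChart H η (τ, s)) (τ, 0) (m * b, b) := by
  have hpi := Real.pi_pos
  have hητ := hη τ
  set k : ℝ := b * Real.pi / (2 * η τ) with hk
  have hk0 : k ≠ 0 := by positivity
  let vel : ℝ → ℝ := fun s => η τ * squash (k * s)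
  have hvel : ContDiff ℝ ∞ vel :=
    contDiff_const.mul (contDiff_squash.comp (contDiff_const.mul contDiff_id))
  have hvd : ∀ s, HasDerivAt vel (η τ * (2 / Real.pi * (1 / (1 + (k * s) ^ 2)) * k)) s := by
    intro s
    have h1 : HasDerivAt (fun s => k * s) k s := by simpa using (hasDerivAt_id s).const_mul k
    exact ((hasDerivAt_squash (k * s)).comp s h1).const_mul (η τ)
  have hγ : ContDiff ℝ ∞ fun s => foliationChart H η (τ, k * s) := by
    refine contDiff_iff_contDiffAt.2 fun s => ?_
    have h := (hH τ _ (abs_mul_squash_lt hητ (k * s))).contDiffAt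
    have h2 : ContDiffAt ℝ ∞ (fun s => (((τ : ℝ), vel s) : ℝ × ℝ)) s :=
      contDiffAt_const.prodMk hvel.contDiffAt
    exact (ContDiffAt.comp (g := H) (f := fun s => (((τ : ℝ), vel s) : ℝ × ℝ)) s h h2).prodMk
      hvel.contDiffAt
  have hγd : ∀ s, HasDerivAt (fun s => foliationChart H η (τ, k * s))
      (deriv (fun s => foliationChart H η (τ, k * s)) s) s := fun s =>
    (hγ.differentiable (by simp) s).hasDerivAt
  refine ⟨fun s => foliationChart H η (τ, k * s), hγ, ?_, fun s => ?_, ?_, ?_, ?_⟩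
  · have hvemb : IsEmbedding (Prod.snd ∘ fun s => foliationChart H η (τ, k * s)) :=
      (((Homeomorph.mulLeft₀ (η τ) hητ.ne').isEmbedding).comp
        (isOpenEmbedding_squash.isEmbedding.comp (Homeomorph.mulLeft₀ k hk0).isEmbedding))
    exact .of_comp hγ.continuous continuous_snd hvemb
  · intro h0
    have h1 : HasDerivAt vel (deriv (fun s => foliationChart H η (τ, k * s)) s).2 s := (hγd s).snd
    rw [h0, Prod.snd_zero] at h1
    have : η τ * (2 / Real.pi * (1 / (1 + (k * s) ^ 2)) * k) ≠ 0 := by positivity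
    exact this ((hvd s).unique h1)
  · exact (Homeomorph.mulLeft₀ k hk0).surjective.range_comp fun s => foliationChart H η (τ, s)
  · simp [foliationChart, squash_zero, hH0]
  · have hv0 : vel 0 = 0 := by simp [vel, squash_zero]
    have hvd0 : HasDerivAt vel b 0 := by
      have h := hvd 0
      convert h using 1
      rw [hk]
      field_simp
      ring
    have h1 : HasDerivAt (fun s => H (τ, vel s)) (m * b) 0 :=
      HasDerivAt.comp (h₂ := fun v => H (τ, v)) 0 (by rwa [hv0]) hvd0
    exact (h1.prodMk hvd0).deriv

end Assembly

end ImpactOscillator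

/-! ### The stable foliation of the impact map -/

theorem theorem3p1 (f : ℝ → ℝ → ℝ) (g : ℝ → ℝ) (T c r : ℝ) (ρ : ℝ → ℝ)
    (hf : ContDiff ℝ ∞ (Function.uncurry f)) (hg : ContDiff ℝ ∞ g)
    (hT : 0 < T) (hgT : Function.Periodic g T)
    (hρ : ContDiff ℝ ∞ ρ) (hρ0 : ρ 0 = 0) (hρr : deriv ρ 0 = -r) (hr0 : 0 < r) (hr1 : r < 1)
    (J : Set ℝ) (hJo : IsOpen J) (hJc : J.OrdConnected)
    (hJ : ∃ δ > 0, ∀ τ ∈ J, ImpactOscillator.initialAcceleration f g c τ ≤ -δ) :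
    ∃ (U : Set (ℝ × ℝ)) (W : ℝ → Set (ℝ × ℝ)),
      IsOpen U ∧ (∀ τ ∈ J, ((τ, 0) : ℝ × ℝ) ∈ U) ∧
      (∀ τ ∈ J,
        ImpactOscillator.IsSmoothCurveThrough (W τ) (τ, 0)
          (2, (1 - r) * ImpactOscillator.initialAcceleration f g c τ) ∧
        (∀ w ∈ W τ, ∃ w' ∈ W τ, ImpactOscillator.ImpactStep f g c ρ w w') ∧
        W τ = ImpactOscillator.localStableSet f g c ρ U (τ, 0)) ∧
      ∃ Φ : (J × ℝ) ≃ₜ U,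
        ∀ τ : J, range (fun s : ℝ => ((Φ (τ, s) : U) : ℝ × ℝ)) = W τ := by
  have hR : Relator.RightUnique (ImpactOscillator.ImpactStep f g c ρ) :=
    fun _ _ _ h h' => h.unique hf hg h'
  have hneg : ∀ τ ∈ J, ImpactOscillator.initialAcceleration f g c τ < 0 := fun τ hτ => by
    obtain ⟨δ, hδ, h⟩ := hJ
    linarith [h τ hτ]
  obtain ⟨H, η, hH⟩ := ImpactOscillator.exists_global_foliation
    (R := ImpactOscillator.ImpactStep f g c ρ) hJo
    (m := fun τ => -2 / ImpactOscillator.initialAcceleration f g c τ / (r - 1)) (fun τ hτ => by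
      obtain ⟨α, β, hα, hβ, hα0, hβ0, hstep⟩ :=
        ImpactOscillator.exists_impactStep_normalForm hf hg hρ hρ0 (hneg τ hτ)
      rw [hρr, neg_neg] at hβ0
      obtain ⟨h, h0, h1, h2, h3⟩ :=
        ImpactOscillator.exists_local_stable_foliation hR hα hβ hr0 hr1 hβ0 hstep
      rw [hα0] at h3
      exact ⟨h, h0, h1, h2, h3⟩)
  have hη : ∀ τ : J, 0 < η τ := fun τ => (hH τ).1
  have hfol := fun τ : J => (hH τ).2.1
  have hemb := ImpactOscillator.isOpenEmbedding_foliationChart hR hη hfol hJo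
  have hleaf : ∀ τ : J, range (fun s => ImpactOscillator.foliationChart H η (τ, s)) =
      ImpactOscillator.localStableSet f g c ρ (range (ImpactOscillator.foliationChart H η))
        (τ, 0) :=
    ImpactOscillator.range_foliationChart_eq hR hη hfol
  refine ⟨range (ImpactOscillator.foliationChart H η), fun τ =>
    ImpactOscillator.localStableSet f g c ρ (range (ImpactOscillator.foliationChart H η)) (τ, 0),
    hemb.isOpen_range, fun τ hτ => ⟨(⟨τ, hτ⟩, 0), ?_⟩, fun τ hτ => ⟨?_, ?_, rfl⟩,
    hemb.isEmbedding.toHomeomorph, hleaf⟩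
  · have h0 := (hH ⟨τ, hτ⟩).2.2.1
    simp only [ImpactOscillator.foliationChart, ImpactOscillator.squash_zero, mul_zero, h0]
  · have ha := hneg τ hτ
    have hr : r - 1 ≠ 0 := by linarith
    have hb : (1 - r) * ImpactOscillator.initialAcceleration f g c τ ≠ 0 :=
      mul_ne_zero (by linarith) ha.ne
    have h := ImpactOscillator.isSmoothCurveThrough_range_foliationChart hη hfol ⟨τ, hτ⟩
      (hH _).2.2.1 (hH _).2.2.2 hb
    rw [hleaf] at h
    have h2 : -2 / ImpactOscillator.initialAcceleration f g c τ / (r - 1) *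
        ((1 - r) * ImpactOscillator.initialAcceleration f g c τ) = 2 := by
      have := ha.ne
      field_simp
      ring
    rwa [h2] at h
  · simp only [← hleaf ⟨τ, hτ⟩]
    rintro _ ⟨s, rfl⟩
    obtain ⟨s', hs'⟩ := ImpactOscillator.exists_step_foliationChart hη hfol ⟨τ, hτ⟩ s
    exact ⟨_, mem_range_self s', hs'⟩
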